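/- Identify $\mathbb R^2_+=\mathbb R\times(0,\infty)$ with the open right half plane $\mathbb C_+$ via $(x,t)\leftrightarrow t+ix$. For $f:\mathbb R\to\mathbb C$ let $(Pf)(x,t)=\frac1\pi\int_{\mathbb R}\frac{t}{t^2+(x-y)^2}f(y)\,dy$ be its Poisson extension; for $1<r<\infty$ the Hardy space $H^r(\mathbb R^2_+)$ is $\{Pf: f\in L^r(\mathbb R)\}$ with $\|Pf\|_{H^r}=\|f\|_{L^r}$. Let $\alpha>0$ and let $\mu$ be a non-negative Borel measure on $\mathbb R^2_+$. - For $s\ge1$ with $\alpha s>1$, $\mu$ is *embedding $\alpha$-Carleson with exponent $s$* if there is $M$ with $\|u\|_{L^s(\mu)}\le M\|u\|_{H^{\alpha s}}$ for all $u\in H^{\alpha s}(\mathbb R^2_+)$. - $\mu$ is *geometric $\alpha$-Carleson* if there is $c$ with $\mu(T(Q))^\alpha\le c\,|Q|$ for all bounded open intervals $Q\subset\mathbb R$, where the tent $T(Q)$ is the set of $(y,t)\in\mathbb R^2_+$ lying in none of the cones $\{(y,t): |x-y|<t\}$ with $x\notin Q$. Let $p,q\in(1,\infty)$, $\frac1p+\frac1{p'}=1$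 and $\alpha q=p$. Let $\theta\in(0,\frac\pi2)$ and let $A$ be the (injective) diagonal operator on $X=\ell_q(\mathbb N)$ with eigenvalues $\lambda_n\in S(\theta)=\{z\ne0:|\arg z|<\theta\}$, and let $(S(t)x)_n=e^{-\lambda_nt}x_n$ be the semigroup generated by $-A$. For $\sigma\in\mathbb R$ let $X_{-\sigma}=\{\xi\in\mathbb C^{\mathbb N}:(\xi_n/(1+\lambda_n)^{\sigma})_n\in\ell_q\}$ with the corresponding norm. A sequence $b=(b_n)$ of complex numbers is *infinite-time $L^p$-admissible* for $A$ if $b\in X_{-1}$ and there is $K>0$ such that for all $\tau>0$, $u\in L^p(0,\tau)$ and $t\in[0,\tau]$ the Bochner integral $\int_0^tS(t-r)b\,u(r)\,dr$ in $X_{-1}$ lies in $X$ and has $\ell_q$-norm at most $K\|u\|_{L^p(0,\tau)}$. Put $\mu=\sum_n|b_n/\lambda_n|^q\,\delta_{\lambda_n^{-1}}$. Then: (a) If $\mu$ is embedding $\alpha$-Carleson (with some exponent $s\ge1$, $\alpha s>1$), then $b\in X_{-\sigma}$ for all $\sigma>\frac1{p'}$, and $b$ is infinite-time $L^p$-admissible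 for $A$. (b) If $b$ is infinite-time $L^p$-admissible for $A$, then $b\in X_{-\sigma}$ for all $\sigma>\frac1{p'}$, and $\mu$ is geometric $\alpha$-Carleson. In particular, if $p\le q$, then $b$ is infinite-time $L^p$-admissible for $A$ if and only if $\mu$ is geometric $\alpha$-Carleson, and also if and only if $\mu$ is embedding $\alpha$-Carleson with exponent $s$, for any $s\ge1$ with $\alpha s>1$. -/

import Mathlib

open MeasureTheory Complex
open scoped NNReal ENNReal

noncomputable section

/-! ### The half plane, Poisson extension, tents, Carleson measures

The upper half space `ℝ²₊ = ℝ × (0,∞)` is identified with the open right half plane, the point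
`(x, t)` corresponding to `z = t + i x`. -/

/-- The open right half plane `ℂ₊`. -/
def rightHalfPlane : Set ℂ := {z | 0 < z.re}

/-- The open sector `S(θ) = {z ≠ 0 : |arg z| < θ}`. -/
def sector (θ : ℝ) : Set ℂ := {z | z ≠ 0 ∧ |z.arg| < θ}

/-- The Poisson kernel `P_t(x) = (1/π) t / (t² + x²)` of the line. -/
def linePoissonKernel (t x : ℝ) : ℝ := Real.pi⁻¹ * (t / (t ^ 2 + x ^ 2))

/-- The Poisson extension of `f`, at the point `(x, t)` written as `z = t + i x`. -/
def poissonExtension (f : ℝ → ℂ) (z : ℂ) : ℂ :=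
  ∫ y : ℝ, (linePoissonKernel z.re (z.im - y) : ℂ) * f y

/-- `μ` (on the half plane) satisfies the embedding `α`-Carleson estimate with exponent `s`:
`‖u‖_{L^s(μ)} ≤ M ‖u‖_{H^{αs}}` for all `u ∈ H^{αs}`. For `1 < αs < ∞` the Hardy space
`H^{αs}` of the half plane consists of the Poisson extensions `u = P f` of `f ∈ L^{αs}(ℝ)`,
with norm `‖P f‖_{H^{αs}} = ‖f‖_{L^{αs}}`. -/
def IsEmbeddingCarleson (α s : ℝ) (μ : Measure ℂ) : Prop :=
  ∃ M : ℝ≥0, ∀ f : ℝ → ℂ, MemLp f (ENNReal.ofReal (α * s)) volume →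
    eLpNorm (poissonExtension f) (ENNReal.ofReal s) (μ.restrict rightHalfPlane)
      ≤ M * eLpNorm f (ENNReal.ofReal (α * s)) volume

/-- The cone `Γ(x) = {(y, t) : t > 0, |x - y| < t}`. -/
def cone (x : ℝ) : Set ℂ := {z | 0 < z.re ∧ |x - z.im| < z.re}

/-- The tent `T(O)`: the complement, in the half plane, of the union of the cones `Γ(x)`
with `x ∉ O`. -/
def tent (O : Set ℝ) : Set ℂ := rightHalfPlane \ ⋃ x ∈ Oᶜ, cone x

/-- `μ` is geometric `α`-Carleson: `μ(T(Q))^α ≤ c |Q|` for all bounded intervals `Q`. -/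
def IsGeometricCarleson (α : ℝ) (μ : Measure ℂ) : Prop :=
  ∃ c : ℝ≥0, ∀ x y : ℝ, x < y →
    μ (tent (Set.Ioo x y)) ^ α ≤ c * volume (Set.Ioo x y)

/-! ### Diagonal systems on `ℓ_q`

A diagonal operator `A` is given by its sequence of eigenvalues `lam n`, which lie in the open
right half plane. In particular they are nonzero, that is, `A` is injective. -/

/-- The discrete measure `∑ₙ |bₙ / λₙ|^q δ_{1/λₙ}`. -/
def diagonalMeasure (q : ℝ) (lam : ℕ → rightHalfPlane) (b : ℕ → ℂ) : Measure ℂ :=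
  Measure.sum fun n =>
    ENNReal.ofReal (‖b n / (lam n : ℂ)‖ ^ q) • Measure.dirac ((lam n : ℂ)⁻¹)

/-- The state space `X = ℓ_q`. -/
abbrev StateSpace (q : ℝ) : Type := lp (fun _ : ℕ => ℂ) (ENNReal.ofReal q)

/-- The sequences `ξ` that belong to `X_{-σ}`: those with `(1 + A)^{-σ} ξ ∈ ℓ_q`. -/
def extrapolationSubmodule (q : ℝ) (lam : ℕ → rightHalfPlane) (σ : ℝ) :
    Submodule ℂ (ℕ → ℂ) where
  carrier := {ξ | Memℓp (fun n => ξ n / (1 + (lam n : ℂ)) ^ (σ : ℂ)) (ENNReal.ofReal q)}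
  add_mem' {ξ η} hξ hη := by
    have h := Memℓp.add hξ hη
    simp only [Set.mem_ofPred_eq]
    convert h using 1
    funext n
    simp [add_div]
  zero_mem' := by
    simp only [Set.mem_ofPred_eq, Pi.zero_apply, zero_div]
    exact zero_memℓp
  smul_mem' c ξ hξ := by
    have h := Memℓp.const_smul hξ c
    simp only [Set.mem_ofPred_eq]
    convert h using 1
    funext n
    simp [mul_div_assoc]

/-- The extrapolation space `X_{-σ}`, a Banach space for the norm `‖(1 + A)^{-σ} ξ‖_{ℓ_q}`. -/
def ExtrapolationSpace (q : ℝ) (lam : ℕ → rightHalfPlane) (σ : ℝ) : Type :=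
  ↥(extrapolationSubmodule q lam σ)

namespace ExtrapolationSpace

variable {q : ℝ} {lam : ℕ → rightHalfPlane} {σ : ℝ}

instance : AddCommGroup (ExtrapolationSpace q lam σ) :=
  inferInstanceAs (AddCommGroup ↥(extrapolationSubmodule q lam σ))

instance : Module ℂ (ExtrapolationSpace q lam σ) :=
  inferInstanceAs (Module ℂ ↥(extrapolationSubmodule q lam σ))

/-- The underlying sequence of an element of `X_{-σ}`. -/
def seq (ξ : ExtrapolationSpace q lam σ) : ℕ → ℂ := ξ.1

theorem weight_ne_zero (lam : ℕ → rightHalfPlane) (σ : ℝ) (n : ℕ) :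
    (1 + (lam n : ℂ)) ^ (σ : ℂ) ≠ 0 := by
  have h : (1 + (lam n : ℂ)) ≠ 0 := by
    intro h0
    have h1 := congrArg Complex.re h0
    have h2 : 0 < (lam n : ℂ).re := (lam n).2
    simp at h1
    linarith
  simp [Complex.cpow_eq_zero_iff, h]

/-- The isomorphism `(1 + A)^{-σ} : X_{-σ} → ℓ_q`. -/
def toStateSpace : ExtrapolationSpace q lam σ ≃ₗ[ℂ] StateSpace q where
  toFun ξ := ⟨fun n => ξ.seq n / (1 + (lam n : ℂ)) ^ (σ : ℂ), ξ.2⟩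
  invFun x := ⟨fun n => x n * (1 + (lam n : ℂ)) ^ (σ : ℂ), by
    have h := lp.memℓp x
    change Memℓp _ _
    convert h using 1
    funext n
    exact mul_div_cancel_right₀ _ (weight_ne_zero lam σ n)⟩
  map_add' ξ η := by
    ext n
    exact add_div _ _ _
  map_smul' c ξ := by
    ext n
    exact mul_div_assoc _ _ _
  left_inv ξ := by
    apply Subtype.ext
    funext n
    exact div_mul_cancel₀ _ (weight_ne_zero lam σ n)
  right_inv x := by
    ext n
    exact mul_div_cancel_right₀ _ (weight_ne_zero lam σ n)

instance [Fact (1 ≤ ENNReal.ofReal q)] : NormedAddCommGroup (ExtrapolationSpace q lam σ) :=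
  NormedAddCommGroup.induced _ (StateSpace q) (toStateSpace (q := q) (lam := lam) (σ := σ))
    toStateSpace.injective

instance [Fact (1 ≤ ENNReal.ofReal q)] : NormedSpace ℂ (ExtrapolationSpace q lam σ) :=
  NormedSpace.induced ℂ _ (StateSpace q) (toStateSpace (q := q) (lam := lam) (σ := σ)).toLinearMap

theorem norm_eq [Fact (1 ≤ ENNReal.ofReal q)] (ξ : ExtrapolationSpace q lam σ) :
    ‖ξ‖ = ‖toStateSpace ξ‖ := rfl

instance [Fact (1 ≤ ENNReal.ofReal q)] : CompleteSpace (ExtrapolationSpace q lam σ) :=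
  let e : ExtrapolationSpace q lam σ ≃ₗᵢ[ℂ] StateSpace q := ⟨toStateSpace, fun _ => rfl⟩
  e.toIsometryEquiv.completeSpace_iff.mpr inferInstance

/-- The diagonal semigroup `(S(t) ξ)ₙ = exp(-λₙ t) ξₙ` on `X_{-σ}`, for `t ≥ 0`. -/
def semigroup (t : ℝ≥0) (ξ : ExtrapolationSpace q lam σ) : ExtrapolationSpace q lam σ :=
  ⟨fun n => Complex.exp (-(lam n : ℂ) * (t : ℝ)) * ξ.seq n, by
    have h : Memℓp (fun n => ξ.seq n / (1 + (lam n : ℂ)) ^ (σ : ℂ)) (ENNReal.ofReal q) := ξ.2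
    refine Memℓp.mono' h fun n => ?_
    have hre : 0 < (lam n : ℂ).re := (lam n).2
    have h1 : ‖Complex.exp (-(lam n : ℂ) * (t : ℝ))‖ ≤ 1 := by
      rw [Complex.norm_exp, Real.exp_le_one_iff]
      simp only [Complex.re_mul_ofReal, Complex.neg_re]
      nlinarith [t.2, mul_nonneg hre.le t.2]
    rw [mul_div_assoc, norm_mul]
    exact mul_le_of_le_one_left (norm_nonneg _) h1⟩

end ExtrapolationSpace

/-- The sequence `b` is an infinite-time `L^p`-admissible input element for the diagonal operator
with eigenvalues `lam` on `X = ℓ_q`: `b` lies in `X_{-1}` and there is `K > 0` such that for all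
`τ > 0`, `u ∈ L^p(0,τ)` and `t ∈ [0,τ]` the Bochner integral `∫₀ᵗ S(t-r) b u(r) dr` in `X_{-1}`
belongs to `X` and has `X`-norm at most `K ‖u‖_{L^p(0,τ)}`. -/
def IsInfiniteTimeAdmissible (p q : ℝ) [Fact (1 ≤ ENNReal.ofReal q)]
    (lam : ℕ → rightHalfPlane) (b : ℕ → ℂ) : Prop :=
  ∃ β : ExtrapolationSpace q lam 1, β.seq = b ∧
    ∃ K : ℝ, 0 < K ∧ ∀ τ : ℝ, 0 < τ → ∀ u : ℝ → ℂ,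
      MemLp u (ENNReal.ofReal p) (volume.restrict (Set.Ioc 0 τ)) →
      ∀ t ∈ Set.Icc 0 τ, ∃ x : StateSpace q,
        (∀ n, x n = (∫ r in (0 : ℝ)..t,
          u r • ExtrapolationSpace.semigroup (t - r).toNNReal β).seq n) ∧
        ‖x‖ ≤ K * (eLpNorm u (ENNReal.ofReal p) (volume.restrict (Set.Ioc 0 τ))).toReal

end

/-! All conditions are compared with one operator, the Stieltjes transform `S g(t) = ∫ g(y) / (t +
|y|) dy`. It is decreasing in `t`, and Hilbert's inequality bounds it from `L^p(ℝ)` to `L^p(0,∞)`.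
Since the eigenvalues lie in a sector, `|1/λ|` is comparable to `Re (1/λ)`. At such points the
Poisson extension of `f` is dominated by `S|f|`, and for non-negative `φ` decreasing on `(0,∞)` the
Poisson extension is at least a multiple of `φ(Re (1/λ))`. Likewise `|λ · Lv(λ)|` is at most a
multiple of `S|v|` at `Re (1/λ)`, where `L` is the Laplace transform.

After time reversal, admissibility says that `v ↦ (bₙ Lv(λₙ))ₙ` is bounded from `L^p(0,∞)` to `ℓ_q`
(`IsLaplaceBounded`), that is, `∫ |λ Lv(λ)|^q dμ(1/λ) ≤ K ‖v‖^q`.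

Embedding implies Laplace boundedness: the embedding is applied to `φ = (S|v|)^(q/s)` on `(0,∞)`. As
`αq = p`, its `L^(αs)` norm is controlled by Hilbert's inequality, whatever `s` is.

Laplace boundedness implies the geometric condition: exponentials `e^(-as)` have Laplace transform
`1/(λ + a)`, and `a = 1/R` gives `μ(|z| ≤ R) ≤ c R^(1/α)`. In a sector, tents and balls about the
origin are interchangeable. Integrating the same resolvent bounds against a power of `a` yields `b ∈
X_{-σ}`.

Geometric implies embedding when `α ≤ 1`: it suffices to integrate powers of the decreasing function
`S|f|` against `μ`, and for decreasing functions the growth bound on balls is enough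
(`tsum_antitone_rpow_le`). -/

noncomputable section


/-! ### Stieltjes transform and Hilbert's inequality -/

/-- The Stieltjes transform of `g`, with respect to the distance to the origin. -/
def stieltjes (g : ℝ → ℝ≥0∞) (t : ℝ) : ℝ≥0∞ := ∫⁻ y, g y / ENNReal.ofReal (t + |y|)

theorem stieltjes_anti (g : ℝ → ℝ≥0∞) {s t : ℝ} (h : s ≤ t) : stieltjes g t ≤ stieltjes g s :=
  lintegral_mono fun y => ENNReal.div_le_div_left (ENNReal.ofReal_le_ofReal (by linarith)) _

theorem measurable_stieltjes (g : ℝ → ℝ≥0∞) : Measurable (stieltjes g) :=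
  Antitone.measurable fun _ _ h => stieltjes_anti g h

/-- The integral is split at `t`: the denominator is at least `t` below and at least `x` above, and
the two pieces give `1 / (1 - a)` and `1 / a`. -/
theorem lintegral_Ioi_rpow_div_le {a t : ℝ} (ha : 0 < a) (ha' : a < 1) (ht : 0 < t) :
    ∫⁻ x in Set.Ioi (0 : ℝ), ENNReal.ofReal (x ^ (-a)) / ENNReal.ofReal (t + x) ≤
      ENNReal.ofReal ((1 / (1 - a) + 1 / a) * t ^ (-a)) := by
  rw [← Set.Ioc_union_Ioi_eq_Ioi ht.le, lintegral_union measurableSet_Ioi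
    (Set.Ioc_disjoint_Ioi le_rfl), add_mul, ENNReal.ofReal_add (by
      have : 0 < 1 - a := by linarith
      positivity) (by positivity)]
  refine add_le_add ?_ ?_
  · have hint : IntegrableOn (fun x : ℝ => x ^ (-a)) (Set.Ioc 0 t) := by
      rw [← intervalIntegrable_iff_integrableOn_Ioc_of_le ht.le]
      exact intervalIntegral.intervalIntegrable_rpow' (by linarith)
    calc _ ≤ ∫⁻ x in Set.Ioc 0 t, ENNReal.ofReal (x ^ (-a) / t) := by
          refine setLIntegral_mono' measurableSet_Ioc fun x hx => ?_
          rw [← ENNReal.ofReal_div_of_pos (by linarith [hx.1])]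
          have := Real.rpow_nonneg hx.1.le (-a)
          exact ENNReal.ofReal_le_ofReal (div_le_div_of_nonneg_left this ht (by linarith [hx.1]))
      _ = ENNReal.ofReal (∫ x in Set.Ioc 0 t, x ^ (-a) / t) := by
          rw [ofReal_integral_eq_lintegral_ofReal (hint.div_const t)]
          filter_upwards [ae_restrict_mem measurableSet_Ioc] with x hx
          have := Real.rpow_nonneg hx.1.le (-a)
          positivity
      _ ≤ _ := by
          refine ENNReal.ofReal_le_ofReal (le_of_eq ?_)
          rw [integral_div, ← intervalIntegral.integral_of_le ht.le,
            integral_rpow (Or.inl (by linarith)), Real.zero_rpow (by linarith),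
            Real.rpow_add_one ht.ne', show -a + 1 = 1 - a by ring]
          have : 1 - a ≠ 0 := by linarith
          field_simp
          ring
  · have hint : IntegrableOn (fun x : ℝ => x ^ (-a - 1)) (Set.Ioi t) :=
      integrableOn_Ioi_rpow_of_lt (by linarith) ht
    calc _ ≤ ∫⁻ x in Set.Ioi t, ENNReal.ofReal (x ^ (-a - 1)) := by
          refine setLIntegral_mono' measurableSet_Ioi fun x (hx : t < x) => ?_
          have hx0 : 0 < x := ht.trans hx
          rw [← ENNReal.ofReal_div_of_pos (by linarith), Real.rpow_sub_one hx0.ne']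
          have := Real.rpow_nonneg hx0.le (-a)
          exact ENNReal.ofReal_le_ofReal (div_le_div_of_nonneg_left this hx0 (by linarith))
      _ = ENNReal.ofReal (∫ x in Set.Ioi t, x ^ (-a - 1)) := by
          rw [ofReal_integral_eq_lintegral_ofReal hint]
          filter_upwards [ae_restrict_mem measurableSet_Ioi] with x hx
          exact Real.rpow_nonneg (ht.trans hx).le _
      _ ≤ _ := by
          refine ENNReal.ofReal_le_ofReal (le_of_eq ?_)
          rw [integral_Ioi_rpow_of_lt (by linarith) ht]
          rw [show -a - 1 + 1 = -a by ring]
          field_simp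

theorem lintegral_comp_abs (φ : ℝ → ℝ≥0∞) :
    ∫⁻ x, φ |x| = 2 * ∫⁻ x in Set.Ioi (0 : ℝ), φ x := by
  have h1 : ∫⁻ x in Set.Ioi (0 : ℝ), φ |x| = ∫⁻ x in Set.Ioi (0 : ℝ), φ x :=
    setLIntegral_congr_fun measurableSet_Ioi fun x (hx : 0 < x) => by
      simp only [abs_of_pos hx]
  have h2 : ∫⁻ x in Set.Iio (0 : ℝ), φ |x| = ∫⁻ x in Set.Ioi (0 : ℝ), φ x := by
    have := (Measure.measurePreserving_neg (volume : Measure ℝ)).setLIntegral_comp_preimage_emb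
      (MeasurableEquiv.neg ℝ).measurableEmbedding (fun x => φ |x|) (Set.Iio 0)
    rw [← this, ← h1]
    simp
  rw [← lintegral_add_compl _ (measurableSet_Ioi (a := (0 : ℝ))), h1, Set.compl_Ioi,
    setLIntegral_congr Iio_ae_eq_Iic.symm, h2, two_mul]

/-- The constant in the estimate of the Stieltjes transform of a power. -/
def schurConst (a : ℝ) : ℝ≥0∞ := 2 * ENNReal.ofReal (1 / (1 - a) + 1 / a)

theorem schurConst_ne_top (a : ℝ) : schurConst a ≠ ∞ :=
  ENNReal.mul_ne_top (by simp) ENNReal.ofReal_ne_top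

theorem lintegral_abs_rpow_div_le {a t : ℝ} (ha : 0 < a) (ha' : a < 1) (ht : 0 < t) :
    ∫⁻ x, ENNReal.ofReal |x| ^ (-a) / ENNReal.ofReal (t + |x|) ≤
      schurConst a * ENNReal.ofReal t ^ (-a) := by
  rw [lintegral_comp_abs fun x => ENNReal.ofReal x ^ (-a) / ENNReal.ofReal (t + x), schurConst,
    mul_assoc]
  gcongr
  have : 0 < 1 - a := by linarith
  rw [ENNReal.ofReal_rpow_of_pos ht, ← ENNReal.ofReal_mul (by positivity)]
  refine le_trans (le_of_eq ?_) (lintegral_Ioi_rpow_div_le ha ha' ht)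
  exact setLIntegral_congr_fun measurableSet_Ioi fun x (hx : 0 < x) => by
    simp only [ENNReal.ofReal_rpow_of_pos hx]

/-- First half of Schur's test: the kernel is shared between the two Hölder factors, with a power of
`|y|` inserted in one and removed from the other. -/
theorem stieltjes_rpow_le {p p' : ℝ} (h : p.HolderConjugate p') {g : ℝ → ℝ≥0∞}
    (hg : AEMeasurable g) {t : ℝ} (ht : 0 < t) :
    stieltjes g t ^ p ≤ schurConst (1 / p) ^ (p / p') * (ENNReal.ofReal t ^ (-(1 / p')) *
      ∫⁻ y, g y ^ p * ENNReal.ofReal |y| ^ (1 / p') / ENNReal.ofReal (t + |y|)) := by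
  have hp := h.pos
  have hp' := h.symm.pos
  have hp1 := h.lt
  have hp1' := h.symm.lt
  -- With this exponent `a * p' = 1 / p` and `a * p = 1 / p'`, both in `(0,1)`, so that both power
  -- integrals converge.
  set a : ℝ := 1 / (p * p') with ha
  set w : ℝ → ℝ≥0∞ := fun y => ENNReal.ofReal |y| with hw
  set k : ℝ → ℝ≥0∞ := fun y => (ENNReal.ofReal (t + |y|))⁻¹ with hk
  have hwm : Measurable w := by fun_prop
  have hkm : Measurable k := by fun_prop
  have hsplit : stieltjes g t =
      ∫⁻ y, ((fun y => g y * w y ^ a * k y ^ (1 / p)) * fun y => w y ^ (-a) * k y ^ (1 / p')) y := by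
    refine lintegral_congr_ae ?_
    filter_upwards [Measure.ae_ne volume (0 : ℝ)] with y hy
    have hw0 : w y ≠ 0 := by simpa [hw] using hy
    have hwt : w y ≠ ∞ := ENNReal.ofReal_ne_top
    have h1 : w y ^ a * w y ^ (-a) = 1 := by
      rw [← ENNReal.rpow_add _ _ hw0 hwt]; simp
    have h2 : k y ^ (1 / p) * k y ^ (1 / p') = k y := by
      rw [← ENNReal.rpow_add_of_nonneg _ _ (by positivity) (by positivity)]
      simp [h.inv_add_inv_eq_one]
    simp only [Pi.mul_apply]
    calc g y / ENNReal.ofReal (t + |y|) = g y * 1 * k y := by rw [mul_one, div_eq_mul_inv]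
      _ = _ := by
        rw [← h1]; nth_rewrite 1 [← h2]; ring
  have hA : ∫⁻ y, (w y ^ (-a) * k y ^ (1 / p')) ^ p' ≤
      schurConst (1 / p) * ENNReal.ofReal t ^ (-(1 / p)) := by
    refine le_trans (le_of_eq (lintegral_congr fun y => ?_))
      (lintegral_abs_rpow_div_le (a := 1 / p) (by positivity) (by
        rw [div_lt_one hp]; exact hp1) ht)
    rw [ENNReal.mul_rpow_of_nonneg _ _ hp'.le, ← ENNReal.rpow_mul, ← ENNReal.rpow_mul,
      one_div_mul_cancel hp'.ne', ENNReal.rpow_one, div_eq_mul_inv]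
    congr 3
    rw [ha]; field_simp
  have hB : ∫⁻ y, (g y * w y ^ a * k y ^ (1 / p)) ^ p =
      ∫⁻ y, g y ^ p * w y ^ (1 / p') / ENNReal.ofReal (t + |y|) := by
    refine lintegral_congr fun y => ?_
    rw [ENNReal.mul_rpow_of_nonneg _ _ hp.le, ENNReal.mul_rpow_of_nonneg _ _ hp.le,
      ← ENNReal.rpow_mul, ← ENNReal.rpow_mul,
      one_div_mul_cancel hp.ne', ENNReal.rpow_one, div_eq_mul_inv]
    congr 3
    rw [ha]; field_simp
  have hH := ENNReal.lintegral_mul_le_Lp_mul_Lq volume h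
    (f := fun y => g y * w y ^ a * k y ^ (1 / p)) (g := fun y => w y ^ (-a) * k y ^ (1 / p'))
    (by fun_prop) (by fun_prop)
  rw [← hsplit, hB] at hH
  calc stieltjes g t ^ p ≤ _ := ENNReal.rpow_le_rpow hH hp.le
    _ = (∫⁻ y, g y ^ p * w y ^ (1 / p') / ENNReal.ofReal (t + |y|)) *
        (∫⁻ y, (w y ^ (-a) * k y ^ (1 / p')) ^ p') ^ (p / p') := by
      rw [ENNReal.mul_rpow_of_nonneg _ _ hp.le, ← ENNReal.rpow_mul, ← ENNReal.rpow_mul,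
        one_div_mul_cancel hp.ne', ENNReal.rpow_one]
      congr 2
      ring
    _ ≤ (∫⁻ y, g y ^ p * w y ^ (1 / p') / ENNReal.ofReal (t + |y|)) *
        (schurConst (1 / p) * ENNReal.ofReal t ^ (-(1 / p))) ^ (p / p') := by gcongr
    _ = _ := by
      rw [ENNReal.mul_rpow_of_nonneg _ _ (by positivity), ← ENNReal.rpow_mul,
        show -(1 / p) * (p / p') = -(1 / p') by field_simp]
      ring

/-- Hilbert's inequality. -/
theorem lintegral_stieltjes_rpow_le {p p' : ℝ} (h : p.HolderConjugate p') {g : ℝ → ℝ≥0∞}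
    (hg : AEMeasurable g) :
    ∫⁻ t in Set.Ioi (0 : ℝ), stieltjes g t ^ p ≤
      schurConst (1 / p) ^ (p / p') * schurConst (1 / p') * ∫⁻ y, g y ^ p := by
  have hp := h.pos
  have hp' := h.symm.pos
  have hp1' := h.symm.lt
  have hC : schurConst (1 / p) ^ (p / p') ≠ ∞ :=
    ENNReal.rpow_ne_top_of_nonneg (by positivity) (schurConst_ne_top _)
  calc _ ≤ ∫⁻ t in Set.Ioi (0 : ℝ), schurConst (1 / p) ^ (p / p') *
        ∫⁻ y, ENNReal.ofReal t ^ (-(1 / p')) *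
          (g y ^ p * ENNReal.ofReal |y| ^ (1 / p') / ENNReal.ofReal (t + |y|)) := by
        refine setLIntegral_mono' measurableSet_Ioi fun t ht => ?_
        refine (stieltjes_rpow_le h hg ht).trans (le_of_eq ?_)
        rw [lintegral_const_mul']
        have : ENNReal.ofReal t ≠ 0 := by simpa using ht
        simp [this]
    _ = schurConst (1 / p) ^ (p / p') * ∫⁻ y, ∫⁻ t in Set.Ioi (0 : ℝ),
        ENNReal.ofReal t ^ (-(1 / p')) *
          (g y ^ p * ENNReal.ofReal |y| ^ (1 / p') / ENNReal.ofReal (t + |y|)) := by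
        rw [lintegral_const_mul' _ _ hC, lintegral_lintegral_swap]
        have : AEMeasurable (fun z : ℝ × ℝ => g z.2) ((volume.restrict (Set.Ioi 0)).prod volume) :=
          hg.comp_snd
        simp only [Function.uncurry_def]
        fun_prop
    -- Second half of Schur's test: the inner integral is the power estimate with `t` and `|y|`
    -- exchanged, and the powers of `|y|` cancel.
    _ ≤ schurConst (1 / p) ^ (p / p') * ∫⁻ y, schurConst (1 / p') * g y ^ p := by
        gcongr 1
        refine lintegral_mono_ae ?_
        filter_upwards [Measure.ae_ne volume (0 : ℝ)] with y hy
        have hw0 : ENNReal.ofReal |y| ≠ 0 := by simpa using hy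
        have hy' : 0 < |y| := abs_pos.2 hy
        calc _ = ∫⁻ t in Set.Ioi (0 : ℝ), (g y ^ p * ENNReal.ofReal |y| ^ (1 / p')) *
              (ENNReal.ofReal |t| ^ (-(1 / p')) / ENNReal.ofReal (|y| + |t|)) := by
              refine setLIntegral_congr_fun measurableSet_Ioi fun t (ht : 0 < t) => ?_
              simp only [abs_of_pos ht, div_eq_mul_inv, add_comm |y|]
              ring
          _ ≤ ∫⁻ t, (g y ^ p * ENNReal.ofReal |y| ^ (1 / p')) *
              (ENNReal.ofReal |t| ^ (-(1 / p')) / ENNReal.ofReal (|y| + |t|)) :=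
              setLIntegral_le_lintegral _ _
          _ ≤ (g y ^ p * ENNReal.ofReal |y| ^ (1 / p')) *
              (schurConst (1 / p') * ENNReal.ofReal |y| ^ (-(1 / p'))) := by
              rw [lintegral_const_mul _ (by fun_prop)]
              gcongr
              exact lintegral_abs_rpow_div_le (by positivity) (by
                rw [div_lt_one hp']; exact hp1') hy'
          _ = schurConst (1 / p') * g y ^ p *
              (ENNReal.ofReal |y| ^ (1 / p') * ENNReal.ofReal |y| ^ (-(1 / p'))) := by ring
          _ = _ := by
              rw [← ENNReal.rpow_add _ _ hw0 ENNReal.ofReal_ne_top]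
              simp
    _ = _ := by
        rw [lintegral_const_mul' _ _ (schurConst_ne_top _), mul_assoc]

theorem exists_lintegral_stieltjes_rpow_le {p : ℝ} (hp : 1 < p) :
    ∃ C : ℝ≥0, ∀ g : ℝ → ℝ≥0∞, AEMeasurable g →
      ∫⁻ t in Set.Ioi (0 : ℝ), stieltjes g t ^ p ≤ C * ∫⁻ y, g y ^ p := by
  have h := Real.HolderConjugate.conjExponent hp
  have hC : schurConst (1 / p) ^ (p / p.conjExponent) * schurConst (1 / p.conjExponent) ≠ ∞ :=
    ENNReal.mul_ne_top (ENNReal.rpow_ne_top_of_nonneg (div_nonneg h.pos.le h.symm.pos.le)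
      (schurConst_ne_top _)) (schurConst_ne_top _)
  refine ⟨(schurConst (1 / p) ^ (p / p.conjExponent) * schurConst (1 / p.conjExponent)).toNNReal,
    fun g hg => ?_⟩
  rw [ENNReal.coe_toNNReal hC]
  exact lintegral_stieltjes_rpow_le h hg

/-! ### Decreasing functions: pointwise bounds and Carleson sums -/

theorem mul_rpow_le_lintegral_of_antitone {F : ℝ → ℝ≥0∞} (hF : Antitone F) {r t : ℝ} (hr : 0 ≤ r) :
    ENNReal.ofReal t * F t ^ r ≤ ∫⁻ x in Set.Ioi (0 : ℝ), F x ^ r := by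
  calc ENNReal.ofReal t * F t ^ r = ∫⁻ _ in Set.Ioc (0 : ℝ) t, F t ^ r := by
        simp [mul_comm]
    _ ≤ ∫⁻ x in Set.Ioc (0 : ℝ) t, F x ^ r :=
        setLIntegral_mono' measurableSet_Ioc fun x hx => ENNReal.rpow_le_rpow (hF hx.2) hr
    _ ≤ _ := lintegral_mono_set Set.Ioc_subset_Ioi_self

/-- A decreasing function that is infinite at some `t > 0` is infinite on `(0, t]`, which Hilbert's
inequality excludes. -/
theorem stieltjes_lt_top {p : ℝ} (hp : 1 < p) {g : ℝ → ℝ≥0∞} (hg : AEMeasurable g)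
    (hg' : ∫⁻ y, g y ^ p ≠ ∞) {t : ℝ} (ht : 0 < t) : stieltjes g t < ∞ := by
  obtain ⟨C, hC⟩ := exists_lintegral_stieltjes_rpow_le hp
  have h1 := (mul_rpow_le_lintegral_of_antitone (t := t) (fun _ _ h => stieltjes_anti g h)
    (by linarith : 0 ≤ p)).trans (hC g hg)
  have h2 : ENNReal.ofReal t * stieltjes g t ^ p < ∞ :=
    h1.trans_lt (ENNReal.mul_lt_top ENNReal.coe_lt_top hg'.lt_top)
  by_contra h3
  rw [not_lt, top_le_iff] at h3
  rw [h3, ENNReal.top_rpow_of_pos (by linarith), ENNReal.mul_top (by simpa using ht)] at h2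
  exact lt_irrefl _ h2

/-- Writing `F^s = F^r (F^r)^(1/α - 1)`, the second factor is at most `(A / t)^(1/α - 1)`, where `A`
is the integral of `F^r`; this needs `α ≤ 1`. What is left is linear in `F^r`, so sum and integral
can be exchanged and the growth hypothesis applied inside. -/
theorem tsum_antitone_rpow_le {m : ℕ → ℝ≥0∞} {t : ℕ → ℝ} (ht : ∀ n, 0 < t n) {α r s : ℝ}
    (hα : 0 < α) (hα1 : α ≤ 1) (hr : 0 < r) (hs : s = r / α) {c : ℝ≥0∞}
    (hm : ∀ R, 0 < R → ∑' n, (if t n ≤ R then m n else 0) ≤ c * ENNReal.ofReal R ^ (1 / α))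
    {F : ℝ → ℝ≥0∞} (hF : Antitone F) :
    ∑' n, m n * F (t n) ^ s ≤
      2 * (c * 2 ^ (1 / α)) * (∫⁻ x in Set.Ioi (0 : ℝ), F x ^ r) ^ (1 / α) := by
  set A := ∫⁻ x in Set.Ioi (0 : ℝ), F x ^ r with hA
  have hFm : Measurable F := hF.measurable
  have h1α : 0 ≤ 1 / α - 1 := by
    rw [sub_nonneg, le_div_iff₀ hα]; linarith
  have hpt : ∀ n, m n * F (t n) ^ s ≤ (2 * A ^ (1 / α - 1)) * ∫⁻ x in Set.Ioi (0 : ℝ),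
      F x ^ r * ENNReal.ofReal x ^ (-(1 / α)) * (if t n ≤ 2 * x then m n else 0) := by
    intro n
    set τ := ENNReal.ofReal (t n) with hτ
    have hτ0 : τ ≠ 0 := by simpa [hτ] using ht n
    have hτt : τ ≠ ∞ := ENNReal.ofReal_ne_top
    have e1 : F (t n) ^ s ≤ A ^ (1 / α - 1) * τ ^ (-(1 / α)) * (τ * F (t n) ^ r) := by
      calc F (t n) ^ s = F (t n) ^ r * (F (t n) ^ r) ^ (1 / α - 1) := by
            rw [← ENNReal.rpow_mul, ← ENNReal.rpow_add_of_nonneg _ _ hr.le (by positivity), hs]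
            congr 1; field_simp; ring
        _ ≤ F (t n) ^ r * (A * τ⁻¹) ^ (1 / α - 1) := by
            gcongr
            rw [← div_eq_mul_inv, ENNReal.le_div_iff_mul_le (Or.inl hτ0) (Or.inl hτt), mul_comm]
            exact mul_rpow_le_lintegral_of_antitone hF hr.le
        _ = A ^ (1 / α - 1) * τ ^ (-(1 / α) + 1) * F (t n) ^ r := by
            rw [ENNReal.mul_rpow_of_nonneg _ _ h1α, ENNReal.inv_rpow, ← ENNReal.rpow_neg,
              show -(1 / α - 1) = -(1 / α) + 1 by ring]
            ring
        _ = _ := by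
            rw [ENNReal.rpow_add _ _ hτ0 hτt, ENNReal.rpow_one]; ring
    -- The mean over the upper half of `(0, t n]` keeps `x` comparable to `t n`; this is the source
    -- of the condition `t n ≤ 2 * x`.
    have e2 : τ * F (t n) ^ r ≤ 2 * ∫⁻ x in Set.Ioc (t n / 2) (t n), F x ^ r := by
      calc τ * F (t n) ^ r = 2 * ∫⁻ _ in Set.Ioc (t n / 2) (t n), F (t n) ^ r := by
            rw [setLIntegral_const, Real.volume_Ioc, sub_half, mul_left_comm, mul_comm τ]
            congr 1
            rw [hτ, ← ENNReal.ofReal_ofNat, ← ENNReal.ofReal_mul (by norm_num)]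
            congr 1; ring
        _ ≤ _ := by
            gcongr 1
            exact setLIntegral_mono' measurableSet_Ioc fun x hx =>
              ENNReal.rpow_le_rpow (hF hx.2) hr.le
    calc m n * F (t n) ^ s
        ≤ m n * (A ^ (1 / α - 1) * τ ^ (-(1 / α)) *
          (2 * ∫⁻ x in Set.Ioc (t n / 2) (t n), F x ^ r)) := by
          gcongr
          exact e1.trans (by gcongr)
      _ = (2 * A ^ (1 / α - 1)) * ∫⁻ x in Set.Ioc (t n / 2) (t n),
          F x ^ r * τ ^ (-(1 / α)) * m n := by
          rw [lintegral_mul_const _ (by fun_prop), lintegral_mul_const _ (by fun_prop)]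
          ring
      _ ≤ (2 * A ^ (1 / α - 1)) * ∫⁻ x in Set.Ioc (t n / 2) (t n),
          F x ^ r * ENNReal.ofReal x ^ (-(1 / α)) * (if t n ≤ 2 * x then m n else 0) := by
          gcongr 1
          refine setLIntegral_mono' measurableSet_Ioc fun x hx => ?_
          rw [if_pos (by linarith [hx.1])]
          gcongr 2
          rw [ENNReal.rpow_neg, ENNReal.rpow_neg, ENNReal.inv_le_inv]
          exact ENNReal.rpow_le_rpow (ENNReal.ofReal_le_ofReal hx.2) (by positivity)
      _ ≤ _ := by
          gcongr 1
          exact lintegral_mono_set fun x hx => (half_pos (ht n)).trans hx.1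
  calc ∑' n, m n * F (t n) ^ s
      ≤ ∑' n, (2 * A ^ (1 / α - 1)) * ∫⁻ x in Set.Ioi (0 : ℝ),
        F x ^ r * ENNReal.ofReal x ^ (-(1 / α)) * (if t n ≤ 2 * x then m n else 0) :=
        ENNReal.tsum_le_tsum hpt
    _ = (2 * A ^ (1 / α - 1)) * ∫⁻ x in Set.Ioi (0 : ℝ),
        F x ^ r * ENNReal.ofReal x ^ (-(1 / α)) * ∑' n, (if t n ≤ 2 * x then m n else 0) := by
        rw [ENNReal.tsum_mul_left, ← lintegral_tsum]
        · simp only [ENNReal.tsum_mul_left]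
        · intro n
          refine (Measurable.mul (by fun_prop) ?_).aemeasurable
          exact Measurable.ite (measurableSet_le (by fun_prop) (by fun_prop)) (by fun_prop)
            (by fun_prop)
    -- The growth hypothesis with `R = 2 * x` cancels the weight `x ^ (-(1 / α))`.
    _ ≤ (2 * A ^ (1 / α - 1)) * ∫⁻ x in Set.Ioi (0 : ℝ), F x ^ r * (c * 2 ^ (1 / α)) := by
        gcongr 1
        refine setLIntegral_mono' measurableSet_Ioi fun x (hx : 0 < x) => ?_
        have hx0 : ENNReal.ofReal x ≠ 0 := by simpa using hx
        calc _ ≤ F x ^ r * ENNReal.ofReal x ^ (-(1 / α)) *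
              (c * ENNReal.ofReal (2 * x) ^ (1 / α)) := by
              gcongr; exact hm _ (by linarith)
          _ = F x ^ r * (c * 2 ^ (1 / α)) *
              (ENNReal.ofReal x ^ (-(1 / α)) * ENNReal.ofReal x ^ (1 / α)) := by
              rw [ENNReal.ofReal_mul (by norm_num), ENNReal.mul_rpow_of_nonneg _ _ (by positivity),
                ENNReal.ofReal_ofNat]
              ring
          _ = _ := by
              rw [← ENNReal.rpow_add _ _ hx0 ENNReal.ofReal_ne_top]; simp
    _ = 2 * (c * 2 ^ (1 / α)) * (A ^ (1 / α - 1) * A ^ (1 : ℝ)) := by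
        rw [lintegral_mul_const _ (by fun_prop), ENNReal.rpow_one]; ring
    _ = _ := by
        rw [← ENNReal.rpow_add_of_nonneg _ _ h1α zero_le_one, sub_add_cancel]


/-! ### Poisson extensions at points of a sector -/

theorem eLpNorm_ofReal_rpow {α E : Type*} [MeasurableSpace α] [NormedAddCommGroup E]
    {μ : Measure α} (f : α → E) {r : ℝ} (hr : 0 < r) :
    eLpNorm f (ENNReal.ofReal r) μ ^ r = ∫⁻ x, ‖f x‖ₑ ^ r ∂μ := by
  rw [eLpNorm_eq_lintegral_rpow_enorm_toReal (by simpa using hr) ENNReal.ofReal_ne_top,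
    ENNReal.toReal_ofReal hr.le, ← ENNReal.rpow_mul, one_div_mul_cancel hr.ne', ENNReal.rpow_one]

theorem eLpNorm_diagonalMeasure_rpow (q : ℝ) (lam : ℕ → rightHalfPlane) (b : ℕ → ℂ) (g : ℂ → ℂ)
    {s : ℝ} (hs : 0 < s) :
    eLpNorm g (ENNReal.ofReal s) ((diagonalMeasure q lam b).restrict rightHalfPlane) ^ s =
      ∑' n, ENNReal.ofReal (‖b n / (lam n : ℂ)‖ ^ q) * ‖g ((lam n : ℂ)⁻¹)‖ₑ ^ s := by
  have hmem : ∀ᵐ z ∂(diagonalMeasure q lam b), z ∈ rightHalfPlane := by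
    refine (Measure.ae_sum_iff' ?_).2 fun n => Measure.ae_smul_measure ?_ _
    · exact measurableSet_lt measurable_const Complex.measurable_re
    · rw [ae_dirac_eq]
      have h : 0 < (lam n : ℂ).re := (lam n).2
      simp only [rightHalfPlane, Filter.eventually_pure, Set.mem_ofPred_eq, Complex.inv_re]
      exact div_pos h (Complex.normSq_pos.2 fun h0 => by simp [h0] at h)
  rw [Measure.restrict_eq_self_of_ae_mem hmem, eLpNorm_ofReal_rpow g hs, diagonalMeasure,
    lintegral_sum_measure]
  simp [lintegral_smul_measure]

theorem linePoissonKernel_nonneg {t : ℝ} (ht : 0 ≤ t) (x : ℝ) : 0 ≤ linePoissonKernel t x := by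
  unfold linePoissonKernel; positivity

theorem measurable_linePoissonKernel (t x : ℝ) :
    Measurable fun y => linePoissonKernel t (x - y) := by
  unfold linePoissonKernel; fun_prop

/-- In the sector `|y| ≤ κ * z.re + d` with `d = |z.im - y|`, and the cross term `z.re * d` is
absorbed by `z.re ^ 2 + d ^ 2`. -/
theorem linePoissonKernel_le {κ : ℝ} (hκ : 0 ≤ κ) {z : ℂ} (hz : 0 < z.re) (hzκ : ‖z‖ ≤ κ * z.re)
    (y : ℝ) : linePoissonKernel z.re (z.im - y) ≤ (κ + 2) / (z.re + |y|) := by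
  have him : |z.im| ≤ κ * z.re := (Complex.abs_im_le_norm z).trans hzκ
  have hy : |y| ≤ κ * z.re + |z.im - y| := by
    have := abs_sub_abs_le_abs_sub y z.im
    rw [abs_sub_comm] at this
    linarith
  have hπ : Real.pi⁻¹ ≤ 1 := inv_le_one_of_one_le₀ (by linarith [Real.pi_gt_three])
  have hpos : 0 < z.re ^ 2 + (z.im - y) ^ 2 := by positivity
  have h1 : z.re / (z.re ^ 2 + (z.im - y) ^ 2) ≤ (κ + 2) / (z.re + |y|) := by
    rw [div_le_div_iff₀ hpos (by positivity), ← sq_abs (z.im - y)]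
    set d := |z.im - y|
    have h2 : z.re * (z.re + |y|) ≤ z.re * (z.re + (κ * z.re + d)) := by gcongr
    nlinarith [sq_nonneg (z.re - d), mul_nonneg hκ (sq_nonneg d), sq_nonneg d, sq_nonneg z.re]
  calc _ ≤ 1 * (z.re / (z.re ^ 2 + (z.im - y) ^ 2)) := by
        unfold linePoissonKernel
        gcongr
    _ ≤ _ := by rw [one_mul]; exact h1

theorem le_linePoissonKernel {κ : ℝ} {z : ℂ} (hz : 0 < z.re)
    (hzκ : ‖z‖ ≤ κ * z.re) {y : ℝ} (hy : y ∈ Set.Ioc 0 z.re) :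
    Real.pi⁻¹ / (1 + (κ + 1) ^ 2) / z.re ≤ linePoissonKernel z.re (z.im - y) := by
  have him : |z.im| ≤ κ * z.re := (Complex.abs_im_le_norm z).trans hzκ
  have hd : |z.im - y| ≤ (κ + 1) * z.re := by
    have := abs_sub z.im y
    rw [abs_of_pos hy.1] at this
    linarith [hy.2]
  have h2 : (z.im - y) ^ 2 ≤ ((κ + 1) * z.re) ^ 2 := by
    rw [← sq_abs (z.im - y)]
    gcongr
  unfold linePoissonKernel
  rw [div_div, div_eq_mul_inv]
  gcongr
  rw [← one_div, div_le_div_iff₀ (by positivity) (by positivity)]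
  nlinarith

theorem lintegral_enorm_poisson_le {κ : ℝ} (hκ : 0 ≤ κ) {z : ℂ} (hz : 0 < z.re)
    (hzκ : ‖z‖ ≤ κ * z.re) (f : ℝ → ℂ) :
    ∫⁻ y, ‖(linePoissonKernel z.re (z.im - y) : ℂ) * f y‖ₑ ≤
      ENNReal.ofReal (κ + 2) * stieltjes (fun y => ‖f y‖ₑ) z.re := by
  rw [stieltjes, ← lintegral_const_mul' _ _ ENNReal.ofReal_ne_top]
  refine lintegral_mono fun y => ?_
  have h0 := linePoissonKernel_nonneg hz.le (z.im - y)
  rw [enorm_mul, ← ofReal_norm (linePoissonKernel _ _ : ℂ), Complex.norm_real,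
    Real.norm_of_nonneg h0, mul_div_assoc', ENNReal.mul_div_right_comm,
    ← ENNReal.ofReal_div_of_pos (by positivity)]
  gcongr
  exact linePoissonKernel_le hκ hz hzκ y

theorem enorm_poissonExtension_le {κ : ℝ} (hκ : 0 ≤ κ) {z : ℂ} (hz : 0 < z.re)
    (hzκ : ‖z‖ ≤ κ * z.re) (f : ℝ → ℂ) :
    ‖poissonExtension f z‖ₑ ≤ ENNReal.ofReal (κ + 2) * stieltjes (fun y => ‖f y‖ₑ) z.re :=
  (enorm_integral_le_lintegral_enorm _).trans (lintegral_enorm_poisson_le hκ hz hzκ f)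

/-- By positivity only `y ∈ (0, Re z]` need be kept; there the kernel is at least a constant over
`Re z`, which the length of the interval compensates. -/
theorem le_enorm_poissonExtension {κ : ℝ} (hκ : 0 ≤ κ) {z : ℂ} (hz : 0 < z.re)
    (hzκ : ‖z‖ ≤ κ * z.re) {r : ℝ} (hr : 1 < r) {φ : ℝ → ℝ} (hφ : ∀ y, 0 ≤ φ y)
    (hL : MemLp (fun y => (φ y : ℂ)) (ENNReal.ofReal r)) {m : ℝ}
    (hm : ∀ y ∈ Set.Ioc 0 z.re, m ≤ φ y) :
    ENNReal.ofReal (Real.pi⁻¹ / (1 + (κ + 1) ^ 2)) * ENNReal.ofReal m ≤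
      ‖poissonExtension (fun y => (φ y : ℂ)) z‖ₑ := by
  have hk := fun y => linePoissonKernel_nonneg hz.le (z.im - y)
  have hfin : stieltjes (fun y => ‖(φ y : ℂ)‖ₑ) z.re < ∞ := by
    refine stieltjes_lt_top hr hL.1.enorm ?_ hz
    rw [← eLpNorm_ofReal_rpow (fun y => (φ y : ℂ)) (by linarith)]
    exact ENNReal.rpow_ne_top_of_nonneg (by linarith) hL.2.ne
  -- Integrability is essential for a lower bound, since the Bochner integral of a non-integrable
  -- function is `0`.
  have hint : Integrable fun y => (linePoissonKernel z.re (z.im - y) : ℂ) * (φ y : ℂ) :=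
    ⟨((measurable_linePoissonKernel _ _).complex_ofReal.aestronglyMeasurable).mul hL.1,
      (lintegral_enorm_poisson_le hκ hz hzκ _).trans_lt
        (ENNReal.mul_lt_top ENNReal.ofReal_lt_top hfin)⟩
  have hint' : Integrable fun y => linePoissonKernel z.re (z.im - y) * φ y := by
    have := hint.re
    simpa [← Complex.ofReal_mul] using this
  have heq : poissonExtension (fun y => (φ y : ℂ)) z =
      ((∫ y, linePoissonKernel z.re (z.im - y) * φ y : ℝ) : ℂ) := by
    rw [poissonExtension, ← integral_complex_ofReal]
    simp
  rw [heq, ← ofReal_norm, Complex.norm_real, Real.norm_of_nonneg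
    (integral_nonneg fun y => mul_nonneg (hk y) (hφ y)),
    ofReal_integral_eq_lintegral_ofReal hint' (.of_forall fun y => mul_nonneg (hk y) (hφ y))]
  set c := Real.pi⁻¹ / (1 + (κ + 1) ^ 2) with hc
  have hc0 : 0 ≤ c := by positivity
  calc ENNReal.ofReal c * ENNReal.ofReal m
      = ∫⁻ _ in Set.Ioc 0 z.re, ENNReal.ofReal (c / z.re) * ENNReal.ofReal m := by
        rw [setLIntegral_const, Real.volume_Ioc, sub_zero, mul_right_comm,
          ← ENNReal.ofReal_mul (p := c / z.re) (by positivity), div_mul_cancel₀ _ hz.ne']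
    _ ≤ ∫⁻ y in Set.Ioc 0 z.re, ENNReal.ofReal (linePoissonKernel z.re (z.im - y) * φ y) := by
        refine setLIntegral_mono' measurableSet_Ioc fun y hy => ?_
        rw [ENNReal.ofReal_mul (hk y)]
        gcongr
        · exact le_linePoissonKernel hz hzκ hy
        · exact hm y hy
    _ ≤ _ := setLIntegral_le_lintegral _ _

/-! ### Laplace transform -/

/-- The Laplace transform on the half line. -/
def laplaceTransform (v : ℝ → ℂ) (l : ℂ) : ℂ := ∫ s in Set.Ioi (0 : ℝ), Complex.exp (-l * s) * v s

/-- From `exp (-x) ≤ 1 / (1 + x)` at `x = s * l.re`, which equals `(1 / l.re) / (1 / l.re + s)`. -/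
theorem lintegral_enorm_laplace_le {l : ℂ} (hl : 0 < l.re) (v : ℝ → ℂ) :
    ∫⁻ s in Set.Ioi (0 : ℝ), ‖Complex.exp (-l * s) * v s‖ₑ ≤
      ENNReal.ofReal (1 / l.re) *
        stieltjes ((Set.Ioi (0 : ℝ)).indicator fun s => ‖v s‖ₑ) (1 / l.re) := by
  rw [stieltjes, ← lintegral_const_mul' _ _ ENNReal.ofReal_ne_top,
    ← lintegral_indicator measurableSet_Ioi]
  refine lintegral_mono fun s => ?_
  by_cases hs : s ∈ Set.Ioi (0 : ℝ)
  · have hs0 : 0 < s := hs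
    rw [Set.indicator_of_mem hs, Set.indicator_of_mem hs, enorm_mul, mul_div_assoc',
      ENNReal.mul_div_right_comm, abs_of_pos hs0, ← ENNReal.ofReal_div_of_pos (by positivity),
      ← ofReal_norm (Complex.exp _), Complex.norm_exp]
    gcongr
    have hre : (-l * (s : ℂ)).re = -(l.re * s) := by simp
    rw [hre, Real.exp_neg, div_div, mul_add, mul_one_div_cancel hl.ne', ← one_div]
    gcongr
    linarith [Real.add_one_le_exp (l.re * s)]
  · simp [Set.indicator_of_notMem hs]

theorem lintegral_indicator_enorm_rpow (v : ℝ → ℂ) {p : ℝ} (hp : 0 < p) :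
    ∫⁻ s, ((Set.Ioi (0 : ℝ)).indicator (fun s => ‖v s‖ₑ) s) ^ p =
      eLpNorm v (ENNReal.ofReal p) (volume.restrict (Set.Ioi 0)) ^ p := by
  rw [eLpNorm_ofReal_rpow v hp, ← lintegral_indicator measurableSet_Ioi]
  refine lintegral_congr fun s => ?_
  by_cases hs : s ∈ Set.Ioi (0 : ℝ) <;> simp [hs, hp]

theorem integrableOn_laplace {l : ℂ} (hl : 0 < l.re) {p : ℝ} (hp : 1 < p) {v : ℝ → ℂ}
    (hv : MemLp v (ENNReal.ofReal p) (volume.restrict (Set.Ioi 0))) :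
    IntegrableOn (fun s : ℝ => Complex.exp (-l * s) * v s) (Set.Ioi 0) := by
  refine ⟨(by fun_prop : Continuous fun s : ℝ => Complex.exp (-l * s)).aestronglyMeasurable.mul
    hv.1, (lintegral_enorm_laplace_le hl v).trans_lt
      (ENNReal.mul_lt_top ENNReal.ofReal_lt_top ?_)⟩
  refine stieltjes_lt_top hp ((aemeasurable_indicator_iff measurableSet_Ioi).2 hv.1.enorm) ?_
    (by positivity)
  rw [lintegral_indicator_enorm_rpow v (by linarith)]
  exact ENNReal.rpow_ne_top_of_nonneg (by linarith) hv.2.ne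

/-- Boundedness of the weighted Laplace transform `L^p(0,∞) → ℓ_q`,
`v ↦ (bₙ (Lv)(λₙ))ₙ`. -/
def IsLaplaceBounded (p q : ℝ) (lam : ℕ → rightHalfPlane) (b : ℕ → ℂ) : Prop :=
  ∃ K : ℝ≥0, ∀ v : ℝ → ℂ, MemLp v (ENNReal.ofReal p) (volume.restrict (Set.Ioi 0)) →
    ∑' n, ‖b n * laplaceTransform v (lam n)‖ₑ ^ q ≤
      K * eLpNorm v (ENNReal.ofReal p) (volume.restrict (Set.Ioi 0)) ^ q

theorem inv_re_pos (l : rightHalfPlane) : 0 < ((l : ℂ)⁻¹).re := by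
  have h : 0 < (l : ℂ).re := l.2
  rw [Complex.inv_re]
  exact div_pos h (Complex.normSq_pos.2 fun h0 => by simp [h0] at h)

theorem norm_inv_le {κ : ℝ} {l : ℂ} (h : ‖l‖ ≤ κ * l.re) : ‖l⁻¹‖ ≤ κ * (l⁻¹).re := by
  rcases eq_or_ne l 0 with rfl | h0
  · simp
  have hn : 0 < ‖l‖ := norm_pos_iff.2 h0
  rw [Complex.inv_re, norm_inv, Complex.normSq_eq_norm_sq, mul_div_assoc', le_div_iff₀ (by positivity)]
  rw [sq, ← mul_assoc, inv_mul_cancel₀ hn.ne', one_mul]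
  exact h

theorem inv_re_le (l : rightHalfPlane) : ((l : ℂ)⁻¹).re ≤ 1 / (l : ℂ).re := by
  have h : 0 < (l : ℂ).re := l.2
  have h0 : 0 < ‖(l : ℂ)‖ := norm_pos_iff.2 fun h0 => by simp [h0] at h
  rw [Complex.inv_re, Complex.normSq_eq_norm_sq, div_le_div_iff₀ (by positivity) h, one_mul, ← sq]
  gcongr
  exact Complex.re_le_norm _

/-- Monotonicity moves the evaluation point from `1 / Re l` down to `Re (1 / l)`, the real part of
the atom of the measure; the factor `‖l‖ / Re l` is at most `κ`. -/
theorem enorm_mul_laplaceTransform_le {κ : ℝ} (l : rightHalfPlane)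
    (hl : ‖(l : ℂ)‖ ≤ κ * (l : ℂ).re) (v : ℝ → ℂ) :
    ‖(l : ℂ) * laplaceTransform v l‖ₑ ≤ ENNReal.ofReal κ *
      stieltjes ((Set.Ioi (0 : ℝ)).indicator fun s => ‖v s‖ₑ) ((l : ℂ)⁻¹).re := by
  have h : 0 < (l : ℂ).re := l.2
  rw [enorm_mul]
  calc _ ≤ ‖(l : ℂ)‖ₑ * (ENNReal.ofReal (1 / (l : ℂ).re) * stieltjes
        ((Set.Ioi (0 : ℝ)).indicator fun s => ‖v s‖ₑ) (1 / (l : ℂ).re)) := by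
        gcongr
        exact (enorm_integral_le_lintegral_enorm _).trans (lintegral_enorm_laplace_le h v)
    _ ≤ _ := by
        rw [← mul_assoc, ← ofReal_norm, ← ENNReal.ofReal_mul (norm_nonneg _)]
        gcongr
        · rw [mul_one_div, div_le_iff₀ h]; exact hl
        · exact stieltjes_anti _ (inv_re_le l)

/-- Turns the `ℓ_q` sum of `bₙ Lv(λₙ)` into an integral against `diagonalMeasure`, whose masses are
the first factors. -/
theorem enorm_mul_rpow_eq (b z : ℂ) (l : rightHalfPlane) {q : ℝ} (hq : 0 < q) :
    ‖b * z‖ₑ ^ q = ENNReal.ofReal (‖b / (l : ℂ)‖ ^ q) * ‖(l : ℂ) * z‖ₑ ^ q := by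
  have h : (l : ℂ) ≠ 0 := fun h0 => by
    have : 0 < (l : ℂ).re := l.2
    simp [h0] at this
  rw [← ENNReal.ofReal_rpow_of_nonneg (norm_nonneg _) hq.le, ofReal_norm,
    ← ENNReal.mul_rpow_of_nonneg _ _ hq.le, ← enorm_mul]
  congr 2
  field_simp

/-! ### From the Carleson embedding to Laplace boundedness -/

theorem IsEmbeddingCarleson.isLaplaceBounded {p q α s κ : ℝ} (hp : 1 < p) (hq : 1 < q)
    (hα : α * q = p) (hκ : 0 ≤ κ) {lam : ℕ → rightHalfPlane}
    (hlam : ∀ n, ‖(lam n : ℂ)‖ ≤ κ * (lam n : ℂ).re) {b : ℕ → ℂ} (hs : 1 ≤ s) (hαs : 1 < α * s)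
    (h : IsEmbeddingCarleson α s (diagonalMeasure q lam b)) : IsLaplaceBounded p q lam b := by
  obtain ⟨M, hM⟩ := h
  obtain ⟨C, hC⟩ := exists_lintegral_stieltjes_rpow_le hp
  have hs0 : 0 < s := by linarith
  have hq0 : 0 < q := by linarith
  have hp0 : 0 < p := by linarith
  have hα0 : 0 < α := by
    by_contra hneg
    nlinarith [mul_nonneg_of_nonpos_of_nonpos (not_lt.1 hneg) (by linarith : -s ≤ 0)]
  set c : ℝ≥0∞ := ENNReal.ofReal (Real.pi⁻¹ / (1 + (κ + 1) ^ 2)) with hc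
  have hc0 : c ≠ 0 := by
    have : 0 < Real.pi⁻¹ / (1 + (κ + 1) ^ 2) := by positivity
    simpa [hc] using this
  have hct : c ≠ ∞ := ENNReal.ofReal_ne_top
  set D : ℝ≥0∞ := ENNReal.ofReal κ ^ q * ((c ^ s)⁻¹ * (M ^ s * (C : ℝ≥0∞) ^ (1 / α))) with hD
  have hDt : D ≠ ∞ := by
    refine ENNReal.mul_ne_top (by simp [hq0.le]) (ENNReal.mul_ne_top ?_ (ENNReal.mul_ne_top ?_ ?_))
    · simp [hc0, hs0, hct]
    · exact ENNReal.rpow_ne_top_of_nonneg hs0.le ENNReal.coe_ne_top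
    · exact ENNReal.rpow_ne_top_of_nonneg (by positivity) ENNReal.coe_ne_top
  refine ⟨D.toNNReal, fun v hv => ?_⟩
  rw [ENNReal.coe_toNNReal hDt]
  set g : ℝ → ℝ≥0∞ := (Set.Ioi (0 : ℝ)).indicator fun s => ‖v s‖ₑ with hg
  set N := eLpNorm v (ENNReal.ofReal p) (volume.restrict (Set.Ioi 0)) with hN
  have hgm : AEMeasurable g := (aemeasurable_indicator_iff measurableSet_Ioi).2 hv.1.enorm
  have hgp : ∫⁻ y, g y ^ p = N ^ p := lintegral_indicator_enorm_rpow v hp0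
  have hfin : ∀ t, 0 < t → stieltjes g t ≠ ∞ := fun t ht => by
    refine (stieltjes_lt_top hp hgm ?_ ht).ne
    rw [hgp]
    exact ENNReal.rpow_ne_top_of_nonneg hp0.le hv.2.ne
  -- The exponent makes `φ ^ s` the `q`-th power of the Stieltjes transform and `φ ^ (α * s)` its
  -- `p`-th power, because `α * q = p`.
  set φ : ℝ → ℝ := (Set.Ioi (0 : ℝ)).indicator fun y => (stieltjes g y).toReal ^ (q / s) with hφ
  have hφ0 : ∀ y, 0 ≤ φ y := fun y => Set.indicator_nonneg (fun _ _ => by positivity) y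
  have hφm : Measurable φ :=
    Measurable.indicator ((measurable_stieltjes g).ennreal_toReal.pow_const _) measurableSet_Ioi
  have hφe : ∀ y, 0 < y → ENNReal.ofReal (φ y) = stieltjes g y ^ (q / s) := fun y hy => by
    rw [hφ, Set.indicator_of_mem (Set.mem_Ioi.2 hy),
      ← ENNReal.ofReal_rpow_of_nonneg ENNReal.toReal_nonneg (by positivity),
      ENNReal.ofReal_toReal (hfin y hy)]
  have hr0 : 0 < α * s := by linarith
  have hφn : eLpNorm (fun y => (φ y : ℂ)) (ENNReal.ofReal (α * s)) volume ^ (α * s) ≤ C * N ^ p := by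
    rw [eLpNorm_ofReal_rpow _ hr0, ← hgp]
    refine le_trans (le_of_eq ?_) (hC g hgm)
    rw [← lintegral_indicator measurableSet_Ioi]
    refine lintegral_congr fun y => ?_
    rw [← ofReal_norm, Complex.norm_real, Real.norm_of_nonneg (hφ0 y)]
    by_cases hy : y ∈ Set.Ioi (0 : ℝ)
    · rw [hφe y hy, Set.indicator_of_mem hy, ← ENNReal.rpow_mul]
      congr 1
      rw [← hα]; field_simp
    · rw [Set.indicator_of_notMem hy, hφ, Set.indicator_of_notMem hy]
      simp [hr0]
  have hL : MemLp (fun y => (φ y : ℂ)) (ENNReal.ofReal (α * s)) := by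
    refine ⟨hφm.complex_ofReal.aestronglyMeasurable, ?_⟩
    have : C * N ^ p < ∞ := ENNReal.mul_lt_top ENNReal.coe_lt_top
      (ENNReal.rpow_lt_top_of_nonneg hp0.le hv.2.ne)
    exact (ENNReal.rpow_lt_top_iff_of_pos hr0).1 (hφn.trans_lt this)
  have hemb := ENNReal.rpow_le_rpow (hM _ hL) hs0.le
  rw [eLpNorm_diagonalMeasure_rpow q lam b _ hs0, ENNReal.mul_rpow_of_nonneg _ _ hs0.le] at hemb
  have hnorm : eLpNorm (fun y => (φ y : ℂ)) (ENNReal.ofReal (α * s)) volume ^ s ≤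
      (C : ℝ≥0∞) ^ (1 / α) * N ^ q := by
    have := ENNReal.rpow_le_rpow hφn (by positivity : 0 ≤ 1 / α)
    rwa [← ENNReal.rpow_mul, ENNReal.mul_rpow_of_nonneg _ _ (by positivity), ← ENNReal.rpow_mul,
      show α * s * (1 / α) = s by field_simp, show p * (1 / α) = q by
        rw [← hα]; field_simp] at this
  have hlow : ∀ n, c ^ s * stieltjes g ((lam n : ℂ)⁻¹).re ^ q ≤
      ‖poissonExtension (fun y => (φ y : ℂ)) ((lam n : ℂ)⁻¹)‖ₑ ^ s := fun n => by
    have ht := inv_re_pos (lam n)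
    have := le_enorm_poissonExtension hκ ht (norm_inv_le (hlam n)) hαs hφ0 hL
      -- As `φ` decreases on `(0,∞)`, its minimum over `(0, t]` is its value at `t`.
      (m := φ ((lam n : ℂ)⁻¹).re) fun y hy => by
        rw [hφ, Set.indicator_of_mem (Set.mem_Ioi.2 ht), Set.indicator_of_mem (Set.mem_Ioi.2 hy.1)]
        exact Real.rpow_le_rpow ENNReal.toReal_nonneg
          (ENNReal.toReal_mono (hfin y hy.1) (stieltjes_anti g hy.2)) (by positivity)
    rw [hφe _ ht] at this
    have := ENNReal.rpow_le_rpow this hs0.le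
    rwa [ENNReal.mul_rpow_of_nonneg _ _ hs0.le, ← ENNReal.rpow_mul,
      div_mul_cancel₀ _ hs0.ne'] at this
  have hcs : c ^ s ≠ 0 := by simp [hc0, hct]
  have hcs' : c ^ s ≠ ∞ := ENNReal.rpow_ne_top_of_nonneg hs0.le hct
  calc ∑' n, ‖b n * laplaceTransform v (lam n)‖ₑ ^ q
      ≤ ∑' n, (ENNReal.ofReal κ ^ q * (c ^ s)⁻¹) * (ENNReal.ofReal (‖b n / (lam n : ℂ)‖ ^ q) *
        ‖poissonExtension (fun y => (φ y : ℂ)) ((lam n : ℂ)⁻¹)‖ₑ ^ s) := by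
        refine ENNReal.tsum_le_tsum fun n => ?_
        rw [enorm_mul_rpow_eq (b n) _ (lam n) hq0]
        calc _ ≤ ENNReal.ofReal (‖b n / (lam n : ℂ)‖ ^ q) *
              (ENNReal.ofReal κ * stieltjes g ((lam n : ℂ)⁻¹).re) ^ q := by
              gcongr
              exact enorm_mul_laplaceTransform_le (lam n) (hlam n) v
          _ = (ENNReal.ofReal κ ^ q * (c ^ s)⁻¹) * (ENNReal.ofReal (‖b n / (lam n : ℂ)‖ ^ q) *
              (c ^ s * stieltjes g ((lam n : ℂ)⁻¹).re ^ q)) := by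
              rw [ENNReal.mul_rpow_of_nonneg _ _ hq0.le]
              calc _ = ENNReal.ofReal κ ^ q * ((c ^ s)⁻¹ * c ^ s) *
                    (ENNReal.ofReal (‖b n / (lam n : ℂ)‖ ^ q) *
                      stieltjes g ((lam n : ℂ)⁻¹).re ^ q) := by
                    rw [ENNReal.inv_mul_cancel hcs hcs']; ring
                _ = _ := by ring
          _ ≤ _ := by gcongr; exact hlow n
    _ ≤ (ENNReal.ofReal κ ^ q * (c ^ s)⁻¹) * (M ^ s * ((C : ℝ≥0∞) ^ (1 / α) * N ^ q)) := by
        rw [ENNReal.tsum_mul_left]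
        gcongr
        exact hemb.trans (by gcongr)
    _ = D * N ^ q := by rw [hD]; ring


/-! ### Tents, balls about the origin and the geometric condition -/

theorem ae_diagonalMeasure_norm_le {q κ : ℝ} {lam : ℕ → rightHalfPlane}
    (hlam : ∀ n, ‖(lam n : ℂ)‖ ≤ κ * (lam n : ℂ).re) (b : ℕ → ℂ) :
    ∀ᵐ z ∂(diagonalMeasure q lam b), 0 < z.re ∧ ‖z‖ ≤ κ * z.re := by
  refine (Measure.ae_sum_iff' ?_).2 fun n => Measure.ae_smul_measure ?_ _
  · exact (measurableSet_lt measurable_const Complex.measurable_re).inter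
      (measurableSet_le measurable_norm (Complex.measurable_re.const_mul κ))
  · rw [ae_dirac_eq]
    exact ⟨inv_re_pos (lam n), norm_inv_le (hlam n)⟩

theorem diagonalMeasure_closedBall (q : ℝ) (lam : ℕ → rightHalfPlane) (b : ℕ → ℂ) (R : ℝ) :
    diagonalMeasure q lam b (Metric.closedBall 0 R) =
      ∑' n, if ‖(lam n : ℂ)⁻¹‖ ≤ R then ENNReal.ofReal (‖b n / (lam n : ℂ)‖ ^ q) else 0 := by
  rw [diagonalMeasure, Measure.sum_apply _ Metric.isClosed_closedBall.measurableSet]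
  refine tsum_congr fun n => ?_
  rw [Measure.smul_apply, Measure.dirac_apply' _ Metric.isClosed_closedBall.measurableSet,
    smul_eq_mul]
  by_cases h : ‖(lam n : ℂ)⁻¹‖ ≤ R
  · rw [if_pos h, Set.indicator_of_mem (by simpa using h)]; simp
  · rw [if_neg h, Set.indicator_of_notMem (by simpa using h)]; simp

/-- A point of the tent lies above the interval, or the cone at its own foot would contain it.
Avoiding the cone at the endpoint `x` then gives `z.re ≤ z.im - x < y - x`. -/
theorem tent_Ioo_subset {κ x y : ℝ} (hκ : 0 ≤ κ) {z : ℂ} (hz : z ∈ tent (Set.Ioo x y))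
    (hzκ : ‖z‖ ≤ κ * z.re) : ‖z‖ ≤ κ * (y - x) := by
  obtain ⟨h0, h1⟩ := hz
  have h0' : 0 < z.re := h0
  have key : ∀ w, w ∉ Set.Ioo x y → z.re ≤ |w - z.im| := fun w hw => by
    by_contra hlt
    exact h1 (Set.mem_biUnion (show w ∈ (Set.Ioo x y)ᶜ from hw) ⟨h0', not_le.1 hlt⟩)
  have him : z.im ∈ Set.Ioo x y := by
    by_contra hn
    have := key _ hn
    simp only [sub_self, abs_zero] at this
    linarith
  have h2 := key x (by simp)
  rw [abs_of_neg (by linarith [him.1])] at h2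
  refine hzκ.trans ?_
  gcongr
  linarith [him.2]

theorem mem_tent_Ioo {R : ℝ} {z : ℂ} (hz : 0 < z.re) (hR : ‖z‖ ≤ R) :
    z ∈ tent (Set.Ioo (-(2 * R)) (2 * R)) := by
  refine ⟨hz, fun h => ?_⟩
  simp only [Set.mem_iUnion] at h
  obtain ⟨w, hw, -, h2⟩ := h
  have h3 : 2 * R ≤ |w| := by
    by_contra hlt
    exact hw (abs_lt.1 (not_le.1 hlt))
  have h4 := abs_sub_abs_le_abs_sub w z.im
  have h5 := Complex.abs_im_le_norm z
  have h6 := Complex.re_le_norm z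
  linarith

theorem laplaceTransform_exp {a : ℝ} {l : ℂ} (h : 0 < l.re + a) :
    laplaceTransform (fun s => ((Real.exp (-(a * s)) : ℝ) : ℂ)) l = (l + a)⁻¹ := by
  have h' : (-(l + a)).re < 0 := by simp; linarith
  calc _ = ∫ s in Set.Ioi (0 : ℝ), Complex.exp (-(l + a) * s) := by
        refine integral_congr_ae (.of_forall fun s => ?_)
        simp only
        rw [Complex.ofReal_exp, ← Complex.exp_add]
        congr 1; push_cast; ring
    _ = _ := by
        rw [integral_exp_mul_complex_Ioi h']
        simp only [Complex.ofReal_zero, mul_zero, Complex.exp_zero, inv_eq_one_div, div_neg, neg_div,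
          neg_neg]

theorem eLpNorm_exp_rpow {a p : ℝ} (ha : 0 < a) (hp : 0 < p) :
    eLpNorm (fun s : ℝ => ((Real.exp (-(a * s)) : ℝ) : ℂ)) (ENNReal.ofReal p)
      (volume.restrict (Set.Ioi 0)) ^ p = ENNReal.ofReal (1 / (a * p)) := by
  rw [eLpNorm_ofReal_rpow _ hp]
  have h : ∫ s in Set.Ioi (0 : ℝ), Real.exp (-(a * p) * s) = 1 / (a * p) := by
    rw [integral_exp_mul_Ioi (by nlinarith)]
    simp
  rw [← h, ofReal_integral_eq_lintegral_ofReal (exp_neg_integrableOn_Ioi 0 (by positivity))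
    (.of_forall fun _ => (Real.exp_pos _).le)]
  refine lintegral_congr fun s => ?_
  rw [← ofReal_norm, Complex.norm_real, Real.norm_of_nonneg (Real.exp_pos _).le,
    ENNReal.ofReal_rpow_of_pos (Real.exp_pos _), ← Real.exp_mul]
  congr 2; ring

theorem add_ofReal_ne_zero (l : rightHalfPlane) {a : ℝ} (ha : 0 < a) : (l : ℂ) + a ≠ 0 := fun h => by
  have hl : 0 < (l : ℂ).re := l.2
  have := congrArg Complex.re h
  simp only [Complex.add_re, Complex.ofReal_re, Complex.zero_re] at this
  linarith

/-- Test functions `exp (-(a * s))`: the Laplace transform is the resolvent factor, and the `p`-th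
power of the norm is `1 / (a * p)`. -/
theorem IsLaplaceBounded.exists_tsum_resolvent_le {p q : ℝ} (hp : 0 < p) (hq : 0 < q)
    {lam : ℕ → rightHalfPlane} {b : ℕ → ℂ} (h : IsLaplaceBounded p q lam b) :
    ∃ c : ℝ≥0, ∀ a : ℝ, 0 < a →
      ∑' n, ‖b n * ((lam n : ℂ) + a)⁻¹‖ₑ ^ q ≤ c * ENNReal.ofReal (1 / a) ^ (q / p) := by
  obtain ⟨K, hK⟩ := h
  refine ⟨K * (1 / p).toNNReal ^ (q / p), fun a ha => ?_⟩
  set v : ℝ → ℂ := fun s => ((Real.exp (-(a * s)) : ℝ) : ℂ) with hv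
  have hvp := eLpNorm_exp_rpow ha hp
  have hvL : MemLp v (ENNReal.ofReal p) (volume.restrict (Set.Ioi 0)) := by
    refine ⟨(by fun_prop : Continuous v).aestronglyMeasurable, ?_⟩
    rw [← ENNReal.rpow_lt_top_iff_of_pos hp, hvp]
    exact ENNReal.ofReal_lt_top
  have hvq : eLpNorm v (ENNReal.ofReal p) (volume.restrict (Set.Ioi 0)) ^ q =
      ENNReal.ofReal (1 / p) ^ (q / p) * ENNReal.ofReal (1 / a) ^ (q / p) := by
    rw [← ENNReal.mul_rpow_of_nonneg _ _ (by positivity), ← ENNReal.ofReal_mul (by positivity),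
      show 1 / p * (1 / a) = 1 / (a * p) by field_simp, ← hvp, ← ENNReal.rpow_mul,
      mul_div_cancel₀ _ hp.ne']
  have hKv := hK v hvL
  rw [hvq, ← mul_assoc] at hKv
  rw [ENNReal.coe_mul, ENNReal.coe_rpow_of_nonneg _ (by positivity)]
  refine le_trans (le_of_eq (tsum_congr fun n => ?_)) hKv
  have hl : 0 < (lam n : ℂ).re := (lam n).2
  rw [laplaceTransform_exp (by linarith)]

/-- The resolvent bound at `a = 1 / R`: if `|1/λ| ≤ R` then `|λ + a| ≤ 2 |λ|`, so each mass in the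
ball is at most `2 ^ q` times a resolvent term. -/
theorem IsLaplaceBounded.exists_tsum_le {p q : ℝ} (hp : 0 < p) (hq : 0 < q)
    {lam : ℕ → rightHalfPlane} {b : ℕ → ℂ} (h : IsLaplaceBounded p q lam b) :
    ∃ c : ℝ≥0, ∀ R, 0 < R →
      ∑' n, (if ‖(lam n : ℂ)⁻¹‖ ≤ R then ENNReal.ofReal (‖b n / (lam n : ℂ)‖ ^ q) else 0) ≤
        c * ENNReal.ofReal R ^ (q / p) := by
  obtain ⟨c, hc⟩ := h.exists_tsum_resolvent_le hp hq
  refine ⟨2 ^ q * c, fun R hR => ?_⟩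
  have hR' : 0 < 1 / R := one_div_pos.2 hR
  have hcR := hc _ hR'
  rw [one_div_one_div] at hcR
  calc _ ≤ ∑' n, 2 ^ q * ‖b n * ((lam n : ℂ) + (1 / R : ℝ))⁻¹‖ₑ ^ q := by
        refine ENNReal.tsum_le_tsum fun n => ?_
        split_ifs with hn
        · have hl : 0 < (lam n : ℂ).re := (lam n).2
          have hne : (lam n : ℂ) ≠ 0 := fun h0 => by simp [h0] at hl
          rw [enorm_mul_rpow_eq (b n) _ (lam n) hq]
          have h1 : (1 : ℝ≥0∞) ≤ 2 * ‖(lam n : ℂ) * ((lam n : ℂ) + (1 / R : ℝ))⁻¹‖ₑ := by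
            rw [← ofReal_norm, ← ENNReal.ofReal_ofNat, ← ENNReal.ofReal_mul (by norm_num),
              ← ENNReal.ofReal_one]
            refine ENNReal.ofReal_le_ofReal ?_
            rw [norm_mul, norm_inv, ← div_eq_mul_inv, mul_div_assoc',
              le_div_iff₀ (norm_pos_iff.2 (add_ofReal_ne_zero _ hR')), one_mul]
            have h2 : 1 / R ≤ ‖(lam n : ℂ)‖ := by
              rw [norm_inv] at hn
              rw [one_div]
              exact inv_le_of_inv_le₀ (norm_pos_iff.2 hne) hn
            calc _ ≤ ‖(lam n : ℂ)‖ + ‖((1 / R : ℝ) : ℂ)‖ := norm_add_le _ _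
              _ ≤ _ := by
                rw [Complex.norm_real, Real.norm_of_nonneg hR'.le]; linarith
          calc ENNReal.ofReal (‖b n / (lam n : ℂ)‖ ^ q)
              = ENNReal.ofReal (‖b n / (lam n : ℂ)‖ ^ q) * 1 ^ q := by simp
            _ ≤ ENNReal.ofReal (‖b n / (lam n : ℂ)‖ ^ q) *
                (2 * ‖(lam n : ℂ) * ((lam n : ℂ) + (1 / R : ℝ))⁻¹‖ₑ) ^ q := by gcongr
            _ = _ := by
                rw [ENNReal.mul_rpow_of_nonneg _ _ hq.le]; ring
        · exact zero_le
    _ ≤ 2 ^ q * (c * ENNReal.ofReal R ^ (q / p)) := by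
        rw [ENNReal.tsum_mul_left]
        gcongr
    _ = _ := by
        rw [ENNReal.coe_mul, ENNReal.coe_rpow_of_nonneg _ hq.le, ENNReal.coe_ofNat, mul_assoc]

theorem IsLaplaceBounded.isGeometricCarleson {p q α κ : ℝ} (hp : 0 < p) (hq : 0 < q)
    (hα : α * q = p) (hκ : 0 < κ) {lam : ℕ → rightHalfPlane}
    (hlam : ∀ n, ‖(lam n : ℂ)‖ ≤ κ * (lam n : ℂ).re) {b : ℕ → ℂ}
    (h : IsLaplaceBounded p q lam b) : IsGeometricCarleson α (diagonalMeasure q lam b) := by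
  obtain ⟨c, hc⟩ := h.exists_tsum_le hp hq
  have hα0 : 0 < α := by
    by_contra hneg
    nlinarith
  refine ⟨c ^ α * κ.toNNReal, fun x y hxy => ?_⟩
  have h1 : diagonalMeasure q lam b (tent (Set.Ioo x y)) ≤
      c * ENNReal.ofReal (κ * (y - x)) ^ (q / p) := by
    refine le_trans (measure_mono_ae ?_) ((diagonalMeasure_closedBall q lam b _).trans_le
      (hc (κ * (y - x)) (mul_pos hκ (by linarith))))
    filter_upwards [ae_diagonalMeasure_norm_le hlam b] with z hz hzt
    exact mem_closedBall_zero_iff.2 (tent_Ioo_subset hκ.le hzt hz.2)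
  calc _ ≤ (c * ENNReal.ofReal (κ * (y - x)) ^ (q / p)) ^ α := ENNReal.rpow_le_rpow h1 hα0.le
    _ = _ := by
      rw [ENNReal.mul_rpow_of_nonneg _ _ hα0.le, ← ENNReal.rpow_mul,
        show q / p * α = 1 by rw [← hα]; field_simp, ENNReal.rpow_one, ENNReal.ofReal_mul hκ.le,
        Real.volume_Ioo, ENNReal.coe_mul, ENNReal.coe_rpow_of_nonneg _ hα0.le, mul_assoc]
      rfl

theorem IsGeometricCarleson.isEmbeddingCarleson {q α s κ : ℝ}
    (hα0 : 0 < α) (hα1 : α ≤ 1) (hκ : 0 ≤ κ) {lam : ℕ → rightHalfPlane}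
    (hlam : ∀ n, ‖(lam n : ℂ)‖ ≤ κ * (lam n : ℂ).re) {b : ℕ → ℂ} (hαs : 1 < α * s)
    (h : IsGeometricCarleson α (diagonalMeasure q lam b)) :
    IsEmbeddingCarleson α s (diagonalMeasure q lam b) := by
  obtain ⟨c, hc⟩ := h
  obtain ⟨C, hC⟩ := exists_lintegral_stieltjes_rpow_le hαs
  have hs0 : 0 < s := by
    by_contra hneg
    nlinarith
  have hr0 : 0 < α * s := by linarith
  set m : ℕ → ℝ≥0∞ := fun n => ENNReal.ofReal (‖b n / (lam n : ℂ)‖ ^ q) with hmdef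
  set t : ℕ → ℝ := fun n => ((lam n : ℂ)⁻¹).re with htdef
  set c' : ℝ≥0∞ := (c * ENNReal.ofReal (4 * (κ + 1))) ^ (1 / α) with hc'
  have hm : ∀ R, 0 < R → ∑' n, (if t n ≤ R then m n else 0) ≤ c' * ENNReal.ofReal R ^ (1 / α) := by
    intro R hR
    have h1 : diagonalMeasure q lam b (Metric.closedBall 0 (κ * R)) ≤
        -- The extra `R` keeps the interval nondegenerate when `κ = 0`.
        diagonalMeasure q lam b (tent (Set.Ioo (-(2 * (κ * R + R))) (2 * (κ * R + R)))) := by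
      refine measure_mono_ae ?_
      filter_upwards [ae_diagonalMeasure_norm_le hlam b] with z hz hzb
      exact mem_tent_Ioo hz.1 ((mem_closedBall_zero_iff.1 hzb).trans (by linarith))
    have h2 := (ENNReal.rpow_le_rpow h1 hα0.le).trans (hc (-(2 * (κ * R + R))) (2 * (κ * R + R))
      (by nlinarith [mul_nonneg hκ hR.le]))
    rw [Real.volume_Ioo, show 2 * (κ * R + R) - -(2 * (κ * R + R)) = 4 * (κ + 1) * R by ring,
      ENNReal.ofReal_mul (by positivity), ← mul_assoc] at h2
    have h3 := ENNReal.rpow_le_rpow h2 (by positivity : 0 ≤ 1 / α)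
    rw [← ENNReal.rpow_mul, mul_one_div_cancel hα0.ne', ENNReal.rpow_one,
      ENNReal.mul_rpow_of_nonneg _ _ (by positivity)] at h3
    refine le_trans (ENNReal.tsum_le_tsum fun n => ?_)
      ((diagonalMeasure_closedBall q lam b (κ * R)).symm.trans_le h3)
    by_cases hn : t n ≤ R
    · rw [if_pos hn, if_pos ((norm_inv_le (hlam n)).trans (by gcongr))]
    · rw [if_neg hn]; exact zero_le
  set D : ℝ≥0∞ := ENNReal.ofReal (κ + 2) ^ s *
    (2 * (c' * 2 ^ (1 / α)) * (C : ℝ≥0∞) ^ (1 / α)) with hD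
  have hDt : D ≠ ∞ := by
    have h1 : 0 ≤ 1 / α := by positivity
    have h2 : c' ≠ ∞ := ENNReal.rpow_ne_top_of_nonneg h1
      (ENNReal.mul_ne_top ENNReal.coe_ne_top ENNReal.ofReal_ne_top)
    refine ENNReal.mul_ne_top (ENNReal.rpow_ne_top_of_nonneg hs0.le ENNReal.ofReal_ne_top)
      (ENNReal.mul_ne_top (ENNReal.mul_ne_top (by simp) (ENNReal.mul_ne_top h2
        (ENNReal.rpow_ne_top_of_nonneg h1 (by simp))))
        (ENNReal.rpow_ne_top_of_nonneg h1 ENNReal.coe_ne_top))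
  refine ⟨(D ^ (1 / s)).toNNReal, fun f hf => ?_⟩
  rw [ENNReal.coe_toNNReal (ENNReal.rpow_ne_top_of_nonneg (by positivity) hDt)]
  set F := stieltjes fun y => ‖f y‖ₑ with hF
  have hFa : Antitone F := fun _ _ h => stieltjes_anti _ h
  have hmain : eLpNorm (poissonExtension f) (ENNReal.ofReal s)
      ((diagonalMeasure q lam b).restrict rightHalfPlane) ^ s ≤
        D * eLpNorm f (ENNReal.ofReal (α * s)) volume ^ s := by
    rw [eLpNorm_diagonalMeasure_rpow q lam b _ hs0]
    calc _ ≤ ∑' n, ENNReal.ofReal (κ + 2) ^ s * (m n * F (t n) ^ s) := by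
          refine ENNReal.tsum_le_tsum fun n => ?_
          rw [mul_left_comm, ← ENNReal.mul_rpow_of_nonneg _ _ hs0.le]
          gcongr
          exact enorm_poissonExtension_le hκ (inv_re_pos (lam n)) (norm_inv_le (hlam n)) f
      _ ≤ ENNReal.ofReal (κ + 2) ^ s * (2 * (c' * 2 ^ (1 / α)) *
          (C * eLpNorm f (ENNReal.ofReal (α * s)) volume ^ (α * s)) ^ (1 / α)) := by
          rw [ENNReal.tsum_mul_left]
          gcongr 1
          refine (tsum_antitone_rpow_le (fun n => inv_re_pos (lam n)) hα0 hα1 hr0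
            (by field_simp) hm hFa).trans ?_
          gcongr
          rw [eLpNorm_ofReal_rpow f hr0]
          exact hC _ hf.1.enorm
      _ = _ := by
          rw [ENNReal.mul_rpow_of_nonneg _ _ (by positivity), ← ENNReal.rpow_mul,
            show α * s * (1 / α) = s by field_simp, hD]
          ring
  have := ENNReal.rpow_le_rpow hmain (by positivity : 0 ≤ 1 / s)
  rwa [ENNReal.mul_rpow_of_nonneg _ _ (by positivity), ← ENNReal.rpow_mul, ← ENNReal.rpow_mul,
    mul_one_div_cancel hs0.ne', ENNReal.rpow_one, ENNReal.rpow_one] at this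


/-! ### Membership in the extrapolation spaces -/

theorem memℓp_of_tsum_enorm_ne_top {q : ℝ} (hq : 0 < q) {f : ℕ → ℂ}
    (h : ∑' n, ‖f n‖ₑ ^ q ≠ ∞) : Memℓp f (ENNReal.ofReal q) := by
  rw [memℓp_gen_iff (by rwa [ENNReal.toReal_ofReal hq.le]), ENNReal.toReal_ofReal hq.le]
  refine (ENNReal.summable_toReal h).congr fun n => ?_
  rw [← ENNReal.toReal_rpow, toReal_enorm]

theorem tsum_enorm_rpow_eq {q : ℝ} (hq : 0 < q) (x : StateSpace q) :
    ∑' n, ‖x n‖ₑ ^ q = ENNReal.ofReal ‖x‖ ^ q := by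
  have hq' : (ENNReal.ofReal q).toReal = q := ENNReal.toReal_ofReal hq.le
  have hs := (memℓp_gen_iff (by rwa [hq'])).1 (lp.memℓp x)
  have h := lp.norm_rpow_eq_tsum (by rwa [hq']) x
  rw [hq'] at hs h
  rw [ENNReal.ofReal_rpow_of_nonneg (lp.norm_nonneg' x) hq.le, h,
    ENNReal.ofReal_tsum_of_nonneg (fun n => by positivity) hs]
  refine tsum_congr fun n => ?_
  rw [← ofReal_norm, ENNReal.ofReal_rpow_of_nonneg (norm_nonneg _) hq.le]

theorem rpow_neg_le_of_mem_Ioc {q σ w a : ℝ} (hq : 1 ≤ q) (hσ : 0 ≤ σ) (hw : 1 ≤ w)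
    (ha : a ∈ Set.Ioc w (2 * w)) {d : ℝ} (hd : 0 < d) (hda : d ≤ w + a) :
    w ^ (-(σ * q)) ≤ 2 ^ (σ * q) * 3 ^ q * (w * (a ^ (q - 1 - σ * q) * d⁻¹ ^ q)) := by
  have hw0 : 0 < w := by linarith
  have ha0 : 0 < a := by linarith [ha.1]
  have h1 : (2 * w) ^ (-(σ * q)) ≤ a ^ (-(σ * q)) :=
    Real.rpow_le_rpow_of_nonpos ha0 ha.2 (by nlinarith)
  have h2 : w ^ (q - 1) ≤ a ^ (q - 1) := Real.rpow_le_rpow hw0.le ha.1.le (by linarith)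
  have h3 : (3 * w)⁻¹ ^ q ≤ d⁻¹ ^ q :=
    Real.rpow_le_rpow (by positivity) (inv_anti₀ hd (by linarith [ha.2])) (by linarith)
  calc w ^ (-(σ * q)) = 2 ^ (σ * q) * 3 ^ q *
        (w * ((w ^ (q - 1) * (2 * w) ^ (-(σ * q))) * (3 * w)⁻¹ ^ q)) := by
        rw [Real.inv_rpow (by positivity), Real.mul_rpow (by norm_num) hw0.le,
          Real.mul_rpow (by norm_num) hw0.le, Real.rpow_neg (by norm_num : (0 : ℝ) ≤ 2),
          Real.rpow_sub_one hw0.ne']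
        field_simp
    _ ≤ 2 ^ (σ * q) * 3 ^ q * (w * ((a ^ (q - 1) * a ^ (-(σ * q))) * d⁻¹ ^ q)) := by gcongr
    _ = _ := by
        rw [← Real.rpow_add ha0]; rfl

/-- The weight `|1 + λ|^(-σq)` is dominated by the integral of `a^(q-1-σq) |λ + a|^(-q)` over `a >
1`. Summing the resolvent bounds inside leaves the integral of `a^(-1 + q(1/p' - σ))`, finite
exactly when `σ > 1/p'`. -/
theorem IsLaplaceBounded.mem_extrapolationSubmodule {p p' q σ : ℝ} (hpp' : p.HolderConjugate p')
    (hq : 1 < q) {lam : ℕ → rightHalfPlane} {b : ℕ → ℂ} (h : IsLaplaceBounded p q lam b)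
    (hσ : 1 / p' < σ) : b ∈ extrapolationSubmodule q lam σ := by
  have hq0 : 0 < q := by linarith
  have hp := hpp'.pos
  have hσ0 : 0 < σ := (one_div_pos.2 hpp'.symm.pos).trans hσ
  obtain ⟨c, hc⟩ := h.exists_tsum_resolvent_le hp hq0
  set w : ℕ → ℝ := fun n => ‖1 + (lam n : ℂ)‖ with hwdef
  have hw1 : ∀ n, 1 ≤ w n := fun n => by
    have hl : 0 < (lam n : ℂ).re := (lam n).2
    refine le_trans ?_ (Complex.re_le_norm _)
    simp only [Complex.add_re, Complex.one_re]
    linarith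
  refine memℓp_of_tsum_enorm_ne_top hq0 ?_
  set e : ℝ := q - 1 - σ * q with he
  set B : ℝ≥0∞ := ENNReal.ofReal (2 ^ (σ * q) * 3 ^ q) with hB
  have hterm : ∀ n, ‖b n / (1 + (lam n : ℂ)) ^ (σ : ℂ)‖ₑ ^ q ≤
      B * ∫⁻ a in Set.Ioi (1 : ℝ), ENNReal.ofReal (a ^ e) * ‖b n * ((lam n : ℂ) + a)⁻¹‖ₑ ^ q := by
    intro n
    have hw0 : 0 < w n := by linarith [hw1 n]
    calc ‖b n / (1 + (lam n : ℂ)) ^ (σ : ℂ)‖ₑ ^ q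
        = ‖b n‖ₑ ^ q * ENNReal.ofReal (w n ^ (-(σ * q))) := by
          rw [div_eq_mul_inv, enorm_mul, ENNReal.mul_rpow_of_nonneg _ _ hq0.le,
            ← ofReal_norm (_⁻¹), norm_inv, Complex.norm_cpow_real,
            ENNReal.ofReal_rpow_of_nonneg (by positivity) hq0.le, ← Real.rpow_neg (norm_nonneg _),
            ← Real.rpow_mul (norm_nonneg _), neg_mul]
      -- The constant is replaced by its mean over `(w, 2w]`, where `a` is comparable to `w` and `|λ
      -- + a| ≤ 3w`.
      _ = (ENNReal.ofReal (w n))⁻¹ * ∫⁻ _ in Set.Ioc (w n) (2 * w n),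
          ‖b n‖ₑ ^ q * ENNReal.ofReal (w n ^ (-(σ * q))) := by
          rw [setLIntegral_const, Real.volume_Ioc, show 2 * w n - w n = w n by ring, mul_left_comm,
            ENNReal.inv_mul_cancel (by simpa using hw0) ENNReal.ofReal_ne_top, mul_one]
      _ ≤ (ENNReal.ofReal (w n))⁻¹ * ∫⁻ a in Set.Ioc (w n) (2 * w n), (ENNReal.ofReal (w n) * B) *
          (ENNReal.ofReal (a ^ e) * ‖b n * ((lam n : ℂ) + a)⁻¹‖ₑ ^ q) := by
          gcongr 1
          refine setLIntegral_mono' measurableSet_Ioc fun a ha => ?_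
          have ha0 : 0 < a := hw0.trans ha.1
          have hne := add_ofReal_ne_zero (lam n) ha0
          have hda : ‖(lam n : ℂ) + a‖ ≤ w n + a := by
            calc ‖(lam n : ℂ) + a‖ = ‖(1 + (lam n : ℂ)) + ((a - 1 : ℝ) : ℂ)‖ := by
                  congr 1; push_cast; ring
              _ ≤ w n + ‖((a - 1 : ℝ) : ℂ)‖ := norm_add_le _ _
              _ ≤ w n + a := by
                  rw [Complex.norm_real, Real.norm_of_nonneg (by linarith [ha.1, hw1 n])]
                  linarith
          have key := ENNReal.ofReal_le_ofReal (rpow_neg_le_of_mem_Ioc hq.le hσ0.le (hw1 n) ha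
            (norm_pos_iff.2 hne) hda)
          rw [ENNReal.ofReal_mul (p := 2 ^ (σ * q) * 3 ^ q) (by positivity),
            ENNReal.ofReal_mul hw0.le,
            ENNReal.ofReal_mul (p := a ^ (q - 1 - σ * q)) (by positivity), ← norm_inv,
            ← ENNReal.ofReal_rpow_of_nonneg (norm_nonneg _) hq0.le,
            ofReal_norm ((lam n : ℂ) + a)⁻¹, ← he, ← hB] at key
          refine (mul_le_mul' le_rfl key).trans (le_of_eq ?_)
          rw [enorm_mul, ENNReal.mul_rpow_of_nonneg _ _ hq0.le]
          ring
      _ = B * ∫⁻ a in Set.Ioc (w n) (2 * w n),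
          (ENNReal.ofReal (a ^ e) * ‖b n * ((lam n : ℂ) + a)⁻¹‖ₑ ^ q) := by
          rw [lintegral_const_mul' _ _ (ENNReal.mul_ne_top ENNReal.ofReal_ne_top
            ENNReal.ofReal_ne_top), ← mul_assoc, ← mul_assoc, ENNReal.inv_mul_cancel
            (by simpa using hw0) ENNReal.ofReal_ne_top, one_mul]
      _ ≤ _ := by
          gcongr 1
          exact lintegral_mono_set fun a ha => (hw1 n).trans_lt ha.1
  have hsum : ∑' n, ‖b n / (1 + (lam n : ℂ)) ^ (σ : ℂ)‖ₑ ^ q ≤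
      B * (c * ENNReal.ofReal (∫ a in Set.Ioi (1 : ℝ), a ^ (e - q / p))) := by
    have hexp : e - q / p < -1 := by
      have h1 : 1 / p = 1 - 1 / p' := by
        have := hpp'.inv_add_inv_eq_one
        rw [one_div, one_div]; linarith
      have h2 : e - q / p = -1 + q * (1 / p' - σ) := by
        rw [he, div_eq_mul_one_div q p, h1]; ring
      nlinarith
    calc _ ≤ ∑' n, B * ∫⁻ a in Set.Ioi (1 : ℝ),
          ENNReal.ofReal (a ^ e) * ‖b n * ((lam n : ℂ) + a)⁻¹‖ₑ ^ q := ENNReal.tsum_le_tsum hterm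
      _ = B * ∫⁻ a in Set.Ioi (1 : ℝ),
          ENNReal.ofReal (a ^ e) * ∑' n, ‖b n * ((lam n : ℂ) + a)⁻¹‖ₑ ^ q := by
          rw [ENNReal.tsum_mul_left, ← lintegral_tsum]
          · simp only [ENNReal.tsum_mul_left]
          · intro n
            fun_prop
      _ ≤ B * ∫⁻ a in Set.Ioi (1 : ℝ), c * ENNReal.ofReal (a ^ (e - q / p)) := by
          gcongr 1
          refine setLIntegral_mono' measurableSet_Ioi fun a (ha : 1 < a) => ?_
          have ha0 : 0 < a := by linarith
          calc _ ≤ ENNReal.ofReal (a ^ e) * (c * ENNReal.ofReal (1 / a) ^ (q / p)) := by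
                gcongr; exact hc a ha0
            _ = _ := by
                rw [ENNReal.ofReal_rpow_of_pos (by positivity), mul_left_comm,
                  ← ENNReal.ofReal_mul (by positivity), one_div, Real.inv_rpow ha0.le,
                  ← Real.rpow_neg ha0.le, ← Real.rpow_add ha0]
                rfl
      _ = _ := by
          rw [lintegral_const_mul' _ _ ENNReal.coe_ne_top, ofReal_integral_eq_lintegral_ofReal
            (integrableOn_Ioi_rpow_of_lt hexp one_pos)]
          filter_upwards [ae_restrict_mem measurableSet_Ioi] with a ha
          exact Real.rpow_nonneg (zero_le_one.trans (le_of_lt ha)) _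
  exact (hsum.trans_lt (ENNReal.mul_lt_top ENNReal.ofReal_lt_top
    (ENNReal.mul_lt_top ENNReal.coe_lt_top ENNReal.ofReal_lt_top))).ne


/-! ### The Bochner integral in coordinates -/

namespace ExtrapolationSpace

variable {q : ℝ} {lam : ℕ → rightHalfPlane} {σ : ℝ}

theorem toStateSpace_apply (ξ : ExtrapolationSpace q lam σ) (n : ℕ) :
    toStateSpace ξ n = ξ.seq n / (1 + (lam n : ℂ)) ^ (σ : ℂ) := rfl

theorem semigroup_seq (t : ℝ≥0) (ξ : ExtrapolationSpace q lam σ) (n : ℕ) :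
    (semigroup t ξ).seq n = Complex.exp (-(lam n : ℂ) * (t : ℝ)) * ξ.seq n := rfl

variable [Fact (1 ≤ ENNReal.ofReal q)]

theorem norm_seq_le (ξ : ExtrapolationSpace q lam σ) (n : ℕ) :
    ‖ξ.seq n‖ ≤ ‖(1 + (lam n : ℂ)) ^ (σ : ℂ)‖ * ‖ξ‖ := by
  have hq : ENNReal.ofReal q ≠ 0 := fun h => by
    have := (Fact.out : 1 ≤ ENNReal.ofReal q)
    simp [h] at this
  have h := lp.norm_apply_le_norm hq (toStateSpace ξ) n
  rw [toStateSpace_apply, norm_div, div_le_iff₀ (norm_pos_iff.2 (weight_ne_zero lam σ n))] at h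
  rw [norm_eq, mul_comm]
  exact h

/-- The coordinate functional `ξ ↦ ξₙ`. -/
def seqCLM (n : ℕ) : ExtrapolationSpace q lam σ →L[ℂ] ℂ :=
  LinearMap.mkContinuous
    { toFun := fun ξ => ξ.seq n
      map_add' := fun _ _ => rfl
      map_smul' := fun _ _ => rfl } _ fun ξ => norm_seq_le ξ n

theorem seqCLM_apply (n : ℕ) (ξ : ExtrapolationSpace q lam σ) : seqCLM n ξ = ξ.seq n := rfl

/-- `toStateSpace` as a linear isometry equivalence. -/
def toStateSpaceₗᵢ : ExtrapolationSpace q lam σ ≃ₗᵢ[ℂ] StateSpace q := ⟨toStateSpace, fun _ => rfl⟩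

theorem norm_semigroup_le (t : ℝ≥0) (ξ : ExtrapolationSpace q lam σ) :
    ‖semigroup t ξ‖ ≤ ‖ξ‖ := by
  have hq : ENNReal.ofReal q ≠ 0 := fun h => by
    have := (Fact.out : 1 ≤ ENNReal.ofReal q)
    simp [h] at this
  rw [norm_eq, norm_eq]
  refine lp.norm_mono hq fun n => ?_
  rw [toStateSpace_apply, toStateSpace_apply, semigroup_seq, mul_div_assoc, norm_mul]
  refine mul_le_of_le_one_left (norm_nonneg _) ?_
  have hre : 0 < (lam n : ℂ).re := (lam n).2
  rw [Complex.norm_exp, Real.exp_le_one_iff]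
  simp only [Complex.re_mul_ofReal, Complex.neg_re]
  nlinarith [t.2, mul_nonneg hre.le t.2]

/-- The orbit is the pointwise limit of its finite coordinate truncations, which are continuous; `q
< ∞` makes them converge. -/
theorem stronglyMeasurable_semigroup (ξ : ExtrapolationSpace q lam σ) (t : ℝ) :
    StronglyMeasurable fun r : ℝ => semigroup (t - r).toNNReal ξ := by
  set G : ℝ → StateSpace q := fun r => toStateSpace (semigroup (t - r).toNNReal ξ) with hG
  have hcoord : ∀ n, Continuous fun r => G r n := fun n => by
    have : (fun r => G r n) = fun r => Complex.exp (-(lam n : ℂ) * ((t - r).toNNReal : ℝ)) *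
        ξ.seq n / (1 + (lam n : ℂ)) ^ (σ : ℂ) := rfl
    rw [this]
    fun_prop
  have hGm : StronglyMeasurable G := by
    refine stronglyMeasurable_of_tendsto (Filter.atTop : Filter (Finset ℕ))
      (f := fun s r => ∑ n ∈ s, lp.single (ENNReal.ofReal q) n (G r n)) (fun s => ?_) ?_
    · refine Continuous.stronglyMeasurable (continuous_finsetSum s fun n _ => ?_)
      exact (lp.singleContinuousLinearMap ℂ (fun _ : ℕ => ℂ) (ENNReal.ofReal q) n).continuous.comp
        (hcoord n)
    · exact tendsto_pi_nhds.2 fun r => lp.hasSum_single ENNReal.ofReal_ne_top (G r)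
  have h := (toStateSpaceₗᵢ (q := q) (lam := lam) (σ := σ)).symm.continuous.comp_stronglyMeasurable
    hGm
  convert h using 1
  funext r
  exact (LinearIsometryEquiv.symm_apply_apply toStateSpaceₗᵢ _).symm

/-- Coordinates are continuous functionals, hence pass through the integral; then `s = t - r`. -/
theorem intervalIntegral_seq (ξ : ExtrapolationSpace q lam σ) {u : ℝ → ℂ} {t : ℝ} (ht : 0 ≤ t)
    (hu : IntervalIntegrable u volume 0 t) (n : ℕ) :
    (∫ r in (0 : ℝ)..t, u r • semigroup (t - r).toNNReal ξ).seq n =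
      ξ.seq n * ∫ s in (0 : ℝ)..t, Complex.exp (-(lam n : ℂ) * s) * u (t - s) := by
  have hint : IntervalIntegrable (fun r => u r • semigroup (t - r).toNNReal ξ) volume 0 t := by
    rw [intervalIntegrable_iff] at hu ⊢
    refine Integrable.mono' (hu.norm.mul_const ‖ξ‖)
      (hu.1.smul (stronglyMeasurable_semigroup ξ t).aestronglyMeasurable) (.of_forall fun r => ?_)
    rw [norm_smul]
    gcongr
    exact norm_semigroup_le _ _
  rw [← seqCLM_apply, ← ContinuousLinearMap.intervalIntegral_comp_comm _ hint,
    ← intervalIntegral.integral_const_mul]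
  have h := intervalIntegral.integral_comp_sub_left (a := 0) (b := t)
    (fun r => seqCLM n (u r • semigroup (t - r).toNNReal ξ)) t
  rw [sub_self, sub_zero] at h
  rw [← h]
  refine intervalIntegral.integral_congr fun s hs => ?_
  rw [Set.uIcc_of_le ht] at hs
  simp only [map_smul, seqCLM_apply, semigroup_seq, sub_sub_cancel, Real.coe_toNNReal _ hs.1,
    smul_eq_mul]
  ring

end ExtrapolationSpace

/-! ### Admissibility and Laplace boundedness -/

theorem measurePreserving_sub_left_Ioo (t : ℝ) :
    MeasurePreserving (fun r => t - r) (volume.restrict (Set.Ioo 0 t))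
      (volume.restrict (Set.Ioo 0 t)) := by
  have h := (Measure.measurePreserving_sub_left (volume : Measure ℝ) t).restrict_preimage
    (measurableSet_Ioo (a := (0 : ℝ)) (b := t))
  simpa using h

/-- The input `r ↦ v (τ - r)`, observed at time `τ`, produces the Laplace transform truncated at
`τ`. Since `K` does not depend on `τ`, the bound survives `τ → ∞`. -/
theorem IsInfiniteTimeAdmissible.isLaplaceBounded {p q : ℝ} (hp : 1 < p) (hq : 1 < q)
    [Fact (1 ≤ ENNReal.ofReal q)] {lam : ℕ → rightHalfPlane} {b : ℕ → ℂ}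
    (h : IsInfiniteTimeAdmissible p q lam b) : IsLaplaceBounded p q lam b := by
  have hq0 : 0 < q := by linarith
  obtain ⟨β, rfl, K, hK, hadm⟩ := h
  refine ⟨K.toNNReal ^ q, fun v hv => ?_⟩
  set N := eLpNorm v (ENNReal.ofReal p) (volume.restrict (Set.Ioi 0)) with hN
  have hfin : ∀ τ : ℝ, 0 < τ →
      ∑' n, ‖β.seq n * ∫ s in (0 : ℝ)..τ, Complex.exp (-(lam n : ℂ) * s) * v s‖ₑ ^ q ≤
        (K.toNNReal ^ q : ℝ≥0) * N ^ q := by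
    intro τ hτ
    have hvτ : MemLp v (ENNReal.ofReal p) (volume.restrict (Set.Ioo 0 τ)) :=
      hv.mono_measure (Measure.restrict_mono Set.Ioo_subset_Ioi_self le_rfl)
    have hu : MemLp (fun r => v (τ - r)) (ENNReal.ofReal p) (volume.restrict (Set.Ioc 0 τ)) := by
      rw [← restrict_Ioo_eq_restrict_Ioc]
      exact hvτ.comp_measurePreserving (measurePreserving_sub_left_Ioo τ)
    have hun : eLpNorm (fun r => v (τ - r)) (ENNReal.ofReal p) (volume.restrict (Set.Ioc 0 τ)) ≤
        N := by
      rw [← restrict_Ioo_eq_restrict_Ioc]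
      exact (eLpNorm_comp_measurePreserving hvτ.1 (measurePreserving_sub_left_Ioo τ)).trans_le
        (eLpNorm_mono_measure _ (Measure.restrict_mono Set.Ioo_subset_Ioi_self le_rfl))
    obtain ⟨x, hx, hxK⟩ := hadm τ hτ _ hu τ ⟨hτ.le, le_rfl⟩
    have hui : IntervalIntegrable (fun r => v (τ - r)) volume 0 τ := by
      rw [intervalIntegrable_iff_integrableOn_Ioc_of_le hτ.le]
      exact hu.integrable (by rw [← ENNReal.ofReal_one]; exact ENNReal.ofReal_le_ofReal hp.le)
    calc _ = ∑' n, ‖x n‖ₑ ^ q := by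
          refine tsum_congr fun n => ?_
          rw [hx n, ExtrapolationSpace.intervalIntegral_seq β hτ.le hui n]
          simp only [sub_sub_cancel]
      _ = ENNReal.ofReal ‖x‖ ^ q := tsum_enorm_rpow_eq hq0 x
      _ ≤ (K.toNNReal * N) ^ q := by
          gcongr
          refine (ENNReal.ofReal_le_ofReal hxK).trans ?_
          rw [ENNReal.ofReal_mul hK.le, ENNReal.ofReal_toReal hu.2.ne]
          exact mul_le_mul_right hun _
      _ = _ := by
          rw [ENNReal.mul_rpow_of_nonneg _ _ hq0.le, ENNReal.coe_rpow_of_nonneg _ hq0.le]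
  -- Only coordinatewise convergence is available, so the limit is taken in finite partial sums.
  rw [ENNReal.tsum_eq_iSup_sum]
  refine iSup_le fun s => ?_
  have hlim : Filter.Tendsto (fun τ : ℝ => ∑ n ∈ s,
      ‖β.seq n * ∫ r in (0 : ℝ)..τ, Complex.exp (-(lam n : ℂ) * r) * v r‖ₑ ^ q) Filter.atTop
      (nhds (∑ n ∈ s, ‖β.seq n * laplaceTransform v (lam n)‖ₑ ^ q)) := by
    refine tendsto_finsetSum s fun n _ => ?_
    have h1 := intervalIntegral_tendsto_integral_Ioi 0 (integrableOn_laplace (lam n).2 hp hv)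
      Filter.tendsto_id
    exact ((ENNReal.continuous_rpow_const.comp continuous_enorm).tendsto _).comp
      (h1.const_mul (β.seq n))
  refine le_of_tendsto hlim ?_
  filter_upwards [Filter.eventually_gt_atTop 0] with τ hτ
  exact (ENNReal.sum_le_tsum s).trans (hfin τ hτ)

/-- The reversed input, extended by zero from `(0, t)`, is an admissible test function with no
larger norm; `b ∈ X_{-1}` because `1 / p' < 1`. -/
theorem IsLaplaceBounded.isInfiniteTimeAdmissible {p p' q : ℝ} (hp : 1 < p) (hq : 1 < q)
    (hpp' : p.HolderConjugate p')
    [Fact (1 ≤ ENNReal.ofReal q)] {lam : ℕ → rightHalfPlane} {b : ℕ → ℂ}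
    (h : IsLaplaceBounded p q lam b) : IsInfiniteTimeAdmissible p q lam b := by
  have hq0 : 0 < q := by linarith
  have hb := h.mem_extrapolationSubmodule hpp' hq (σ := 1) (by
    rw [div_lt_one hpp'.symm.pos]; exact hpp'.symm.lt)
  obtain ⟨β, rfl⟩ : ∃ β : ExtrapolationSpace q lam 1, β.seq = b := ⟨⟨b, hb⟩, rfl⟩
  obtain ⟨K, hK⟩ := h
  -- The summand `1` only secures strict positivity.
  refine ⟨β, rfl, K ^ (1 / q) + 1, by positivity, fun τ hτ u hu t ht => ?_⟩
  set N := eLpNorm u (ENNReal.ofReal p) (volume.restrict (Set.Ioc 0 τ)) with hN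
  have hsub : Set.Ioo 0 t ⊆ Set.Ioc 0 τ := fun x hx => ⟨hx.1, hx.2.le.trans ht.2⟩
  have hut : MemLp u (ENNReal.ofReal p) (volume.restrict (Set.Ioo 0 t)) :=
    hu.mono_measure (Measure.restrict_mono hsub le_rfl)
  set v : ℝ → ℂ := (Set.Ioo 0 t).indicator fun s => u (t - s) with hv
  have hvr : MemLp (fun s => u (t - s)) (ENNReal.ofReal p) (volume.restrict (Set.Ioo 0 t)) :=
    hut.comp_measurePreserving (measurePreserving_sub_left_Ioo t)
  have hvL : MemLp v (ENNReal.ofReal p) (volume.restrict (Set.Ioi 0)) :=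
    ((memLp_indicator_iff_restrict measurableSet_Ioo).2 hvr).mono_measure Measure.restrict_le_self
  have hvN : eLpNorm v (ENNReal.ofReal p) (volume.restrict (Set.Ioi 0)) ≤ N := by
    calc _ ≤ eLpNorm v (ENNReal.ofReal p) volume :=
          eLpNorm_mono_measure _ Measure.restrict_le_self
      _ = eLpNorm (fun s => u (t - s)) (ENNReal.ofReal p) (volume.restrict (Set.Ioo 0 t)) :=
          eLpNorm_indicator_eq_eLpNorm_restrict measurableSet_Ioo
      _ = eLpNorm u (ENNReal.ofReal p) (volume.restrict (Set.Ioo 0 t)) :=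
          eLpNorm_comp_measurePreserving hut.1 (measurePreserving_sub_left_Ioo t)
      _ ≤ N := eLpNorm_mono_measure _ (Measure.restrict_mono hsub le_rfl)
  have hui : IntervalIntegrable u volume 0 t := by
    rw [intervalIntegrable_iff_integrableOn_Ioo_of_le ht.1]
    exact hut.integrable (by rw [← ENNReal.ofReal_one]; exact ENNReal.ofReal_le_ofReal hp.le)
  have hlap : ∀ n, laplaceTransform v (lam n) =
      ∫ s in (0 : ℝ)..t, Complex.exp (-(lam n : ℂ) * s) * u (t - s) := fun n => by
    rw [intervalIntegral.integral_of_le ht.1, ← restrict_Ioo_eq_restrict_Ioc, laplaceTransform,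
      ← integral_indicator measurableSet_Ioo, ← integral_indicator measurableSet_Ioi]
    refine integral_congr_ae (.of_forall fun s => ?_)
    by_cases hs : s ∈ Set.Ioo 0 t
    · simp [hv, Set.indicator_of_mem hs, show 0 < s from hs.1]
    · by_cases hs' : s ∈ Set.Ioi (0 : ℝ)
      · rw [Set.indicator_of_notMem hs, Set.indicator_of_mem hs', hv, Set.indicator_of_notMem hs,
          mul_zero]
      · rw [Set.indicator_of_notMem hs, Set.indicator_of_notMem hs']
  have hbound := (hK v hvL).trans (mul_le_mul_right (ENNReal.rpow_le_rpow hvN hq0.le) _)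
  have hNt : N ≠ ∞ := hu.2.ne
  obtain ⟨x, hx⟩ : ∃ x : StateSpace q, ∀ n, x n = β.seq n * laplaceTransform v (lam n) :=
    ⟨⟨_, memℓp_of_tsum_enorm_ne_top hq0 (hbound.trans_lt (ENNReal.mul_lt_top ENNReal.coe_lt_top
      (ENNReal.rpow_lt_top_of_nonneg hq0.le hNt))).ne⟩, fun _ => rfl⟩
  refine ⟨x, fun n => ?_, ?_⟩
  · rw [ExtrapolationSpace.intervalIntegral_seq _ ht.1 hui n, ← hlap n, hx n]
  · simp only [← hx] at hbound
    have h1 : ENNReal.ofReal ‖x‖ ^ q ≤ K * N ^ q := (tsum_enorm_rpow_eq hq0 x).symm.trans_le hbound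
    have h2 := ENNReal.rpow_le_rpow h1 (by positivity : 0 ≤ 1 / q)
    rw [ENNReal.mul_rpow_of_nonneg _ _ (by positivity), ← ENNReal.rpow_mul, ← ENNReal.rpow_mul,
      mul_one_div_cancel hq0.ne', ENNReal.rpow_one, ENNReal.rpow_one,
      ← ENNReal.coe_rpow_of_nonneg _ (by positivity)] at h2
    have h3 := ENNReal.toReal_mono (ENNReal.mul_ne_top ENNReal.coe_ne_top hNt) h2
    rw [ENNReal.toReal_ofReal (norm_nonneg _), ENNReal.toReal_mul, ENNReal.coe_toReal,
      NNReal.coe_rpow] at h3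
    nlinarith [ENNReal.toReal_nonneg (a := N)]

theorem norm_le_of_mem_sector {θ : ℝ} (hθ : 0 < θ) (hθ' : θ < Real.pi / 2) {z : ℂ}
    (hz : z ∈ sector θ) : ‖z‖ ≤ (Real.cos θ)⁻¹ * z.re := by
  have hc : 0 < Real.cos θ := Real.cos_pos_of_mem_Ioo ⟨by linarith, hθ'⟩
  have h1 : Real.cos θ ≤ Real.cos z.arg := by
    rw [← Real.cos_abs z.arg]
    exact Real.cos_le_cos_of_nonneg_of_le_pi (abs_nonneg _) (by linarith [Real.pi_pos]) hz.2.le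
  rw [inv_mul_eq_div, le_div_iff₀ hc]
  calc ‖z‖ * Real.cos θ ≤ ‖z‖ * Real.cos z.arg := by gcongr
    _ = z.re := Complex.norm_mul_cos_arg z

end

theorem mainTheorem2 (p p' q α θ : ℝ) (hp : 1 < p) (hq : 1 < q)
    [Fact (1 ≤ ENNReal.ofReal q)] (hpp' : p.HolderConjugate p') (hα : α * q = p)
    (hθ : 0 < θ) (hθ' : θ < Real.pi / 2)
    (lam : ℕ → rightHalfPlane) (hlam : ∀ n, (lam n : ℂ) ∈ sector θ) (b : ℕ → ℂ) :
    -- an embedding Carleson estimate, for whichever exponent `s`, implies admissibility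
    (∀ s : ℝ, 1 ≤ s → 1 < α * s → IsEmbeddingCarleson α s (diagonalMeasure q lam b) →
      (∀ σ : ℝ, 1 / p' < σ → b ∈ extrapolationSubmodule q lam σ) ∧
      IsInfiniteTimeAdmissible p q lam b) ∧
    -- admissibility implies the geometric Carleson property
    (IsInfiniteTimeAdmissible p q lam b →
      (∀ σ : ℝ, 1 / p' < σ → b ∈ extrapolationSubmodule q lam σ) ∧
      IsGeometricCarleson α (diagonalMeasure q lam b)) ∧
    -- for `p ≤ q`, admissibility is characterised by either Carleson property
    (p ≤ q →
      (IsInfiniteTimeAdmissible p q lam b ↔ IsGeometricCarleson α (diagonalMeasure q lam b)) ∧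
      (∀ s : ℝ, 1 ≤ s → 1 < α * s →
        (IsInfiniteTimeAdmissible p q lam b ↔
          IsEmbeddingCarleson α s (diagonalMeasure q lam b)))) := by
  have hc : 0 < Real.cos θ := Real.cos_pos_of_mem_Ioo ⟨by linarith, hθ'⟩
  have hκ : 0 < (Real.cos θ)⁻¹ := inv_pos.2 hc
  have hl : ∀ n, ‖(lam n : ℂ)‖ ≤ (Real.cos θ)⁻¹ * (lam n : ℂ).re := fun n =>
    norm_le_of_mem_sector hθ hθ' (hlam n)
  have hp0 : 0 < p := by linarith
  have hq0 : 0 < q := by linarith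
  have emb_lap : ∀ s : ℝ, 1 ≤ s → 1 < α * s → IsEmbeddingCarleson α s (diagonalMeasure q lam b) →
      IsLaplaceBounded p q lam b := fun s hs hαs h =>
    h.isLaplaceBounded hp hq hα hκ.le hl hs hαs
  have adm_lap : IsInfiniteTimeAdmissible p q lam b → IsLaplaceBounded p q lam b := fun h =>
    h.isLaplaceBounded hp hq
  have lap_adm : IsLaplaceBounded p q lam b → IsInfiniteTimeAdmissible p q lam b := fun h =>
    h.isInfiniteTimeAdmissible hp hq hpp'
  have lap_geo : IsLaplaceBounded p q lam b → IsGeometricCarleson α (diagonalMeasure q lam b) :=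
    fun h => h.isGeometricCarleson hp0 hq0 hα hκ hl
  refine ⟨fun s hs hαs h => ⟨fun σ hσ => ?_, lap_adm (emb_lap s hs hαs h)⟩,
    fun h => ⟨fun σ hσ => ?_, lap_geo (adm_lap h)⟩, fun hpq => ?_⟩
  · exact (emb_lap s hs hαs h).mem_extrapolationSubmodule hpp' hq hσ
  · exact (adm_lap h).mem_extrapolationSubmodule hpp' hq hσ
  · have hα1 : α ≤ 1 := by
      by_contra hlt
      nlinarith [mul_lt_mul_of_pos_right (not_le.1 hlt) hq0]
    have hα0 : 0 < α := by
      by_contra hneg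
      nlinarith
    have geo_emb : IsGeometricCarleson α (diagonalMeasure q lam b) → ∀ s : ℝ, 1 < α * s →
        IsEmbeddingCarleson α s (diagonalMeasure q lam b) := fun h s hαs =>
      h.isEmbeddingCarleson hα0 hα1 hκ.le hl hαs
    -- The geometric condition passes through the embedding with `s = q`, allowed since `α * q = p >
    -- 1`.
    refine ⟨⟨fun h => lap_geo (adm_lap h), fun h => lap_adm (emb_lap q hq.le (by linarith)
      (geo_emb h q (by linarith)))⟩, fun s hs hαs => ⟨fun h => geo_emb (lap_geo (adm_lap h)) s hαs,
      fun h => lap_adm (emb_lap s hs hαs h)⟩⟩
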